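/- Let $k$ be a field, let $X=\mathbb{P}^1_k$ be the projective line over $k$, and let $\mathrm{QCoh}(X)$ be the category of quasicoherent sheaves on $X$, a full subcategory of the category of all $\mathcal{O}_X$-modules. A short exact sequence $0\to\mathcal{A}\to\mathcal{B}\to\mathcal{C}\to 0$ of quasicoherent sheaves is called g-pure-exact (geometrically pure exact) if for every $\mathcal{O}_X$-module $\mathcal{Y}$ (not necessarily quasicoherent) the sequence $0\to\mathcal{Y}\otimes\mathcal{A}\to\mathcal{Y}\otimes\mathcal{B}\to\mathcal{Y}\otimes\mathcal{C}\to 0$ is exact, where $\otimes$ is the tensor product of sheaves of $\mathcal{O}_X$-modules. A coherent sheaf $\mathcal{T}$ on $X$ is torsion if for every affine open $U\subseteq X$ the $\mathcal{O}_X(U)$-module $\mathcal{T}(U)$ is torsion; it is indecomposable if it is nonzero and is not isomorphic to a direct sum of two nonzero sheaves of $\mathcal{O}_X$-modules. **Proposition.** Let $0\to\mathcal{A}\to\mathcal{B}\to\mathcal{C}\to 0$ be a short exact sequence in $\mathrm{QCoh}(\mathbb{P}^1_k)$. Then the following statements are equivalent: 1. The sequence is g-pure-exact. 2. For each torsion coherent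 sheaf $\mathcal{T}$, the sequence $0\to\mathcal{T}\otimes\mathcal{A}\to\mathcal{T}\otimes\mathcal{B}\to\mathcal{T}\otimes\mathcal{C}\to 0$ is exact. 3. For each indecomposable torsion coherent sheaf $\mathcal{T}$, the sequence $0\to\mathcal{T}\otimes\mathcal{A}\to\mathcal{T}\otimes\mathcal{B}\to\mathcal{T}\otimes\mathcal{C}\to 0$ is exact. 4. For each torsion coherent sheaf $\mathcal{T}$, the sequence $0\to\mathrm{Hom}_{\mathrm{QCoh}(\mathbb{P}^1_k)}(\mathcal{T},\mathcal{A})\to\mathrm{Hom}_{\mathrm{QCoh}(\mathbb{P}^1_k)}(\mathcal{T},\mathcal{B})\to\mathrm{Hom}_{\mathrm{QCoh}(\mathbb{P}^1_k)}(\mathcal{T},\mathcal{C})\to 0$ is exact. 5. For each indecomposable torsion coherent sheaf $\mathcal{T}$, the sequence $0\to\mathrm{Hom}_{\mathrm{QCoh}(\mathbb{P}^1_k)}(\mathcal{T},\mathcal{A})\to\mathrm{Hom}_{\mathrm{QCoh}(\mathbb{P}^1_k)}(\mathcal{T},\mathcal{B})\to\mathrm{Hom}_{\mathrm{QCoh}(\mathbb{P}^1_k)}(\mathcal{T},\mathcal{C})\to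 0$ is exact. -/

import Mathlib

open CategoryTheory MonoidalCategory AlgebraicGeometry Opposite

universe u

noncomputable section

namespace GPure

/-- The category `QCoh(X)` of quasicoherent sheaves on a scheme `X`, as a full subcategory of
the category of all `𝒪_X`-modules. -/
abbrev QCoh (X : Scheme.{u}) : Type (u + 1) :=
  ObjectProperty.FullSubcategory (C := X.Modules) fun M => SheafOfModules.IsQuasicoherent M

/-- The inclusion of `QCoh(X)` into the category of all `𝒪_X`-modules. -/
abbrev QCoh.incl (X : Scheme.{u}) : QCoh X ⥤ X.Modules :=
  ObjectProperty.ι (C := X.Modules) fun M => SheafOfModules.IsQuasicoherent M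

/-- The presheaf tensor product functor `M ↦ (U ↦ Y(U) ⊗_{𝒪_X(U)} M(U))`. -/
def presheafTensor {X : Scheme.{u}} (Y : X.PresheafOfModules) :
    X.PresheafOfModules ⥤ X.PresheafOfModules :=
  tensorLeft (C := PresheafOfModules.{u} (X.presheaf ⋙ forget₂ CommRingCat RingCat)) Y

/-- The sheaf tensor product functor `Y ⊗ -` on `𝒪_X`-modules: `Y ⊗ M` is the sheaf associated
with the presheaf `U ↦ Y(U) ⊗_{𝒪_X(U)} M(U)`. -/
def sheafTensor {X : Scheme.{u}} (Y : X.Modules) : X.Modules ⥤ X.Modules :=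
  Scheme.Modules.toPresheafOfModules X ⋙
    presheafTensor ((Scheme.Modules.toPresheafOfModules X).obj Y) ⋙
      PresheafOfModules.sheafification (𝟙 X.ringCatSheaf.obj)

instance {X : Scheme.{u}} (Y : X.PresheafOfModules) :
    (presheafTensor Y).PreservesZeroMorphisms where
  map_zero M N := by
    apply PresheafOfModules.hom_ext
    intro U
    exact MonoidalPreadditive.whiskerLeft_zero (C := ModuleCat (X.presheaf.obj U)) (X := Y.obj U)

instance {X : Scheme.{u}} :
    (Scheme.Modules.toPresheafOfModules X).PreservesZeroMorphisms where
  map_zero _ _ := rfl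

instance {X : Scheme.{u}} (Y : X.Modules) : (sheafTensor Y).PreservesZeroMorphisms where
  map_zero M N := by
    have h : (PresheafOfModules.sheafification (𝟙 X.ringCatSheaf.obj)).PreservesZeroMorphisms :=
      inferInstance
    change (PresheafOfModules.sheafification (𝟙 X.ringCatSheaf.obj)).map
      ((presheafTensor _).map ((Scheme.Modules.toPresheafOfModules X).map 0)) = _
    rw [Functor.map_zero, Functor.map_zero]
    exact h.map_zero _ _

/-- A sequence of `𝒪_X`-modules is geometrically pure exact (g-pure-exact) if
`0 → Y ⊗ A → Y ⊗ B → Y ⊗ C → 0` is exact for every `𝒪_X`-module `Y`. -/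
def IsGPureExact {X : Scheme.{u}} (S : ShortComplex X.Modules) : Prop :=
  ∀ Y : X.Modules, (S.map (sheafTensor Y)).ShortExact

/-- Coherent sheaves on a (locally noetherian) scheme: quasicoherent sheaves whose sections over
each affine open form a finitely generated module. -/
def IsCoherent {X : Scheme.{u}} (M : X.Modules) : Prop :=
  SheafOfModules.IsQuasicoherent M ∧
    ∀ U : X.Opens, IsAffineOpen U → Module.Finite Γ(X, U) Γ(M, U)

/-- Torsion (quasicoherent) sheaves on an integral scheme: every section over every affine open
`U` is killed by a non-zero-divisor of `𝒪_X(U)`. -/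
def IsTorsion {X : Scheme.{u}} (M : X.Modules) : Prop :=
  ∀ U : X.Opens, IsAffineOpen U → Module.IsTorsion Γ(X, U) Γ(M, U)

/-- The projective line over `k`, i.e. `Proj k[x₀, x₁]`. -/
def P1 (k : Type u) [Field k] : Scheme.{u} :=
  letI := MvPolynomial.gradedAlgebra (σ := Fin 2) (R := k)
  Proj (MvPolynomial.homogeneousSubmodule (Fin 2) k)

end GPure

end

/-! All five conditions are equivalent to one local property, `LinearMap.LiftsTorsionBy`, on each of
the two standard charts: for every function `d` on the chart, sections of `C` killed by `d` lift to
sections of `B` killed by `d`. The chart rings `R` are domains and quotients of `k[x]`, hence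
principal ideal domains.

From sheaves to the local property: for an irreducible `p` of `R` and `n ≠ 0`, the scheme `Spec (R /
p ^ n)` has one point, and the direct image `T` of its structure sheaf is an indecomposable torsion
coherent sheaf with sections `R / p ^ n` on the chart (`TwoCharts.exists_torsion`). If `T ⊗ A → T ⊗
B` is mono, it is injective on chart sections before sheafification, by quasicoherence, and this
forces `p ^ n`-torsion to lift. On the Hom side, a section of `C` killed by `p ^ n` is a map on the
chart from `T` to `C`; it extends to a global map, whose lift to `B` gives the required section. The
structure theorem then passes from prime powers to every `d`.

From the local property back: by the structure theorem every map from a finitely generated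
`R`-module to the sections of `C` lifts, so the sections of `A` are a pure submodule of those of
`B`. Purity localizes to basic opens, these form a basis, and sheafification is exact, so the
sequence is g-pure-exact (`TwoCharts.isGPureExact`). For a torsion coherent `T`, a map to `C` lifts
on each chart. On the overlap the two lifts differ by a map into `A`. Since `T` is torsion that map
extends to a whole chart, so one lift can be corrected and the two glue (`TwoCharts.exists_lift`).

The projective line enters only through `TwoCharts` and integrality. -/

noncomputable section

/-! ### Purity and torsion lifting over a principal ideal domain -/

section Algebra

open TensorProduct

variable {R : Type*} [CommRing R]

/-- Every element of `C` killed by `d` lifts along `g` to an element killed by `d`. -/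
def LinearMap.LiftsTorsionBy {B C : Type*} [AddCommGroup B] [AddCommGroup C] [Module R B]
    [Module R C] (g : B →ₗ[R] C) (d : R) : Prop :=
  ∀ c : C, d • c = 0 → ∃ b : B, d • b = 0 ∧ g b = c

section

variable {A B C : Type*} [AddCommGroup A] [AddCommGroup B] [AddCommGroup C]
  [Module R A] [Module R B] [Module R C] {f : A →ₗ[R] B} {g : B →ₗ[R] C}

/-- By the structure theorem `M` is free plus a sum of modules `R / p ^ e`. The free part is
projective, and a map out of `R / p ^ e` is the same as an element killed by `p ^ e`. -/
theorem LinearMap.exists_lift_of_finite_of_liftsTorsionBy [IsDomain R] [IsPrincipalIdealRing R]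
    (hg : Function.Surjective g) (H : ∀ p : R, Irreducible p → ∀ n : ℕ, g.LiftsTorsionBy (p ^ n))
    {M : Type*} [AddCommGroup M] [Module R M] [Module.Finite R M] (φ : M →ₗ[R] C) :
    ∃ ψ : M →ₗ[R] B, g ∘ₗ ψ = φ := by
  classical
  obtain ⟨n, ι, _, p, hp, e, ⟨E⟩⟩ := Module.equiv_free_prod_directSum (R := R) (M := M)
  obtain ⟨ψ₁, hψ₁⟩ := Module.projective_lifting_property g
    (φ ∘ₗ E.symm.toLinearMap ∘ₗ LinearMap.inl R _ _) hg
  have hcyc (i : ι) : ∃ ψ : (R ⧸ R ∙ p i ^ e i) →ₗ[R] B,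
      g ∘ₗ ψ = φ ∘ₗ E.symm.toLinearMap ∘ₗ LinearMap.inr R _ _ ∘ₗ
        DirectSum.lof R ι (fun i ↦ R ⧸ R ∙ p i ^ e i) i := by
    set χ := φ ∘ₗ E.symm.toLinearMap ∘ₗ LinearMap.inr R _ _ ∘ₗ
        DirectSum.lof R ι (fun i ↦ R ⧸ R ∙ p i ^ e i) i
    obtain ⟨b, hb, hgb⟩ := H (p i) (hp i) (e i) (χ (Submodule.Quotient.mk 1)) (by
      rw [← map_smul, ← Submodule.Quotient.mk_smul,
        (Submodule.Quotient.mk_eq_zero _).2 (by simp), map_zero])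
    refine ⟨Submodule.liftQSpanSingleton _ (LinearMap.toSpanSingleton R B b) (by simpa using hb), ?_⟩
    ext
    change g ((LinearMap.toSpanSingleton R B b) 1) = _
    rw [LinearMap.toSpanSingleton_apply, one_smul, hgb]
    rfl
  choose ψ₂ hψ₂ using hcyc
  refine ⟨(ψ₁.coprod (DirectSum.toModule R ι B ψ₂)) ∘ₗ E.toLinearMap, ?_⟩
  have : g ∘ₗ (ψ₁.coprod (DirectSum.toModule R ι B ψ₂)) = φ ∘ₗ E.symm.toLinearMap := by
    apply LinearMap.prod_ext
    · rw [LinearMap.comp_assoc, LinearMap.coprod_inl, hψ₁, LinearMap.comp_assoc]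
    · rw [LinearMap.comp_assoc, LinearMap.coprod_inr]
      apply DirectSum.linearMap_ext
      intro i
      have h : DirectSum.toModule R ι B ψ₂ ∘ₗ DirectSum.lof R ι _ i = ψ₂ i := by
        ext; simp
      rw [LinearMap.comp_assoc, h, hψ₂]
      rfl
  rw [← LinearMap.comp_assoc, this]
  ext; simp

/-- An element killed by `d` is a map from the finite module `R / d`. The case `d = 0` is included,
the module then being free. -/
theorem LinearMap.liftsTorsionBy_of_irreducible_pow [IsDomain R] [IsPrincipalIdealRing R]
    (hg : Function.Surjective g) (H : ∀ p : R, Irreducible p → ∀ n : ℕ, g.LiftsTorsionBy (p ^ n))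
    (d : R) : g.LiftsTorsionBy d := by
  intro c hc
  obtain ⟨ψ, hψ⟩ := LinearMap.exists_lift_of_finite_of_liftsTorsionBy hg H
    (M := R ⧸ R ∙ d) (Submodule.liftQSpanSingleton _ (LinearMap.toSpanSingleton R C c) (by simpa))
  refine ⟨ψ (Submodule.Quotient.mk 1), ?_, ?_⟩
  · rw [← map_smul, ← Submodule.Quotient.mk_smul,
      (Submodule.Quotient.mk_eq_zero _).2 (by simp), map_zero]
  · have := LinearMap.congr_fun hψ (Submodule.Quotient.mk 1)
    rw [LinearMap.comp_apply] at this
    rw [this]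
    change (LinearMap.toSpanSingleton R C c) 1 = c
    simp

/-- If every finitely generated submodule of `C` lifts to `B`, the kernel of `B → C` is pure. -/
theorem LinearMap.rTensor_injective_of_exists_lift (hf : Function.Injective f)
    (hfg : Function.Exact f g)
    (H : ∀ N : Submodule R C, N.FG → ∃ ψ : N →ₗ[R] B, g ∘ₗ ψ = N.subtype)
    (Y : Type*) [AddCommGroup Y] [Module R Y] : Function.Injective (f.rTensor Y) := by
  rw [injective_iff_map_eq_zero]
  intro x hx
  -- The tensor lives over a finitely generated `P` in `A`, and its image already vanishes over some
  -- finitely generated `Q` in `B` containing `f(P)`.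
  obtain ⟨P, hP, y, rfl⟩ := TensorProduct.exists_of_fg x
  let f' : P →ₗ[R] P.map f := f.submoduleMap P
  have h1 : (f'.rTensor Y) y ∈ LinearMap.ker ((P.map f).subtype.rTensor Y) := by
    rw [LinearMap.mem_ker, ← hx, ← LinearMap.rTensor_comp_apply, ← LinearMap.rTensor_comp_apply]
    rfl
  obtain ⟨Q, hPQ, hQ, h2⟩ := TensorProduct.eq_zero_of_fg_of_subtype_eq_zero (hP.map f) h1
  obtain ⟨ψ, hψ⟩ := H (Q.map g) (hQ.map g)
  -- Subtracting the lift of `g` pushes `Q` into the kernel of `g`, that is, the image of `f`. This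
  -- yields `r : Q → A` inverting `f` on `f(P)`, so the tensor vanishes over `A` too.
  let r₀ : Q →ₗ[R] B := Q.subtype - ψ ∘ₗ g.submoduleMap Q
  have hr₀ (q : Q) : r₀ q ∈ LinearMap.range f := by
    refine (hfg _).1 ?_
    have := LinearMap.congr_fun hψ (g.submoduleMap Q q)
    simp only [LinearMap.comp_apply, Submodule.subtype_apply] at this
    simp [r₀, this]
  let r : Q →ₗ[R] A := (LinearEquiv.ofInjective f hf).symm.toLinearMap ∘ₗ
    LinearMap.codRestrict (LinearMap.range f) r₀ hr₀
  have hr : r ∘ₗ Submodule.inclusion hPQ ∘ₗ f' = P.subtype := by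
    ext p
    apply hf
    have h3 : f (r (Submodule.inclusion hPQ (f' p))) = r₀ (Submodule.inclusion hPQ (f' p)) := by
      have := LinearEquiv.ofInjective_apply (h := hf) f ((LinearEquiv.ofInjective f hf).symm
        (LinearMap.codRestrict (LinearMap.range f) r₀ hr₀ (Submodule.inclusion hPQ (f' p))))
      rw [LinearEquiv.apply_symm_apply] at this
      exact this.symm
    have h4 : g.submoduleMap Q (Submodule.inclusion hPQ (f' p)) = 0 := by
      ext
      exact hfg.apply_apply_eq_zero _
    simp only [LinearMap.comp_apply, Submodule.subtype_apply]
    rw [h3]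
    simp only [r₀, LinearMap.sub_apply, LinearMap.comp_apply, h4, map_zero, sub_zero]
    rfl
  rw [← hr, ← LinearMap.comp_assoc, LinearMap.rTensor_comp_apply, LinearMap.rTensor_comp_apply]
  rw [LinearMap.rTensor_comp_apply, h2, map_zero, map_zero]

theorem LinearMap.lTensor_injective_of_liftsTorsionBy [IsDomain R] [IsPrincipalIdealRing R]
    (hf : Function.Injective f) (hfg : Function.Exact f g) (hg : Function.Surjective g)
    (H : ∀ d : R, g.LiftsTorsionBy d)
    (Y : Type*) [AddCommGroup Y] [Module R Y] : Function.Injective (f.lTensor Y) := by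
  rw [LinearMap.lTensor_inj_iff_rTensor_inj]
  refine LinearMap.rTensor_injective_of_exists_lift hf hfg (fun N hN ↦ ?_) Y
  have : Module.Finite R N := Module.Finite.iff_fg.2 hN
  exact LinearMap.exists_lift_of_finite_of_liftsTorsionBy hg (fun p _ n ↦ H (p ^ n)) _

/-- If tensoring with a cyclic module `R / d` preserves injectivity of `A → B`, then `d`-torsion
lifts from the cokernel. -/
theorem LinearMap.liftsTorsionBy_of_lTensor_injective (hfg : Function.Exact f g)
    (hg : Function.Surjective g) {d : R} {T : Type*} [AddCommGroup T] [Module R T]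
    (e : T ≃ₗ[R] R ⧸ Ideal.span {d}) (h : Function.Injective (f.lTensor T)) :
    g.LiftsTorsionBy d := by
  intro c hc
  obtain ⟨b, rfl⟩ := hg c
  obtain ⟨a, ha⟩ := (hfg (d • b)).1 (by rw [map_smul, hc])
  set t₀ : T := e.symm 1
  have ht₀ : d • t₀ = 0 := by
    rw [← map_smul]
    have : d • (1 : R ⧸ Ideal.span {d}) = 0 := by
      rw [Algebra.smul_def, mul_one]
      exact Ideal.Quotient.eq_zero_iff_mem.2 (Ideal.mem_span_singleton_self d)
    rw [this, map_zero]
  -- `t₀ ⊗ a` maps to `t₀ ⊗ d • b = d • t₀ ⊗ b = 0`. Hence `a` vanishes in `A / dA`, and writing `a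
  -- = d • a'` lets `b - f a'` replace `b`.
  have h0 : t₀ ⊗ₜ[R] a = 0 := h (by
    rw [LinearMap.lTensor_tmul, ha, TensorProduct.tmul_smul, TensorProduct.smul_tmul', ht₀,
      TensorProduct.zero_tmul, map_zero])
  have h1 : (Ideal.Quotient.mk (Ideal.span {d}) 1) ⊗ₜ[R] a = 0 := by
    have := congrArg (e.toLinearMap.rTensor A) h0
    simpa [t₀] using this
  have h2 : a ∈ Ideal.span {d} • (⊤ : Submodule R A) := by
    have := congrArg (TensorProduct.quotTensorEquivQuotSMul A (Ideal.span {d})) h1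
    rw [TensorProduct.quotTensorEquivQuotSMul_mk_tmul] at this
    simpa using this
  rw [Submodule.ideal_span_singleton_smul, Submodule.mem_smul_pointwise_iff_exists] at h2
  obtain ⟨a', -, rfl⟩ := h2
  refine ⟨b - f a', ?_, by rw [map_sub, hfg.apply_apply_eq_zero, sub_zero]⟩
  rw [smul_sub, ← ha, map_smul, sub_self]

end

/-! ### Torsion modules and localization away from an element -/

/-- A nonzero `d` in a PID is a product of a divisor of a power of `t` and a factor coprime
to `t`. -/
theorem exists_dvd_pow_mul_isCoprime [IsDomain R] [IsPrincipalIdealRing R] (t : R) {d : R}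
    (hd : d ≠ 0) : ∃ a q : R, d = a * q ∧ (∃ n : ℕ, a ∣ t ^ n) ∧ IsCoprime q t := by
  induction d using UniqueFactorizationMonoid.induction_on_prime with
  | h₁ => exact absurd rfl hd
  | h₂ x hx => exact ⟨1, x, by simp, ⟨0, by simp⟩, ⟨↑hx.unit⁻¹, 0, by simp⟩⟩
  | h₃ x p hx hp ih =>
    obtain ⟨a, q, rfl, ⟨n, hn⟩, hq⟩ := ih hx
    by_cases hpt : p ∣ t
    · exact ⟨p * a, q, by ring, ⟨n + 1, by rw [pow_succ']; exact mul_dvd_mul hpt hn⟩, hq⟩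
    · exact ⟨a, p * q, by ring, ⟨n, hn⟩, ((hp.irreducible.coprime_iff_not_dvd).2 hpt).mul_left hq⟩

/-- Over a PID, every homomorphism between the localizations away from `t` of a finite torsion
module and an arbitrary module is induced by a homomorphism of the modules themselves. -/
theorem IsLocalizedModule.Away.exists_lift_of_isTorsion [IsDomain R] [IsPrincipalIdealRing R]
    (t : R) {M M' A A' : Type*} [AddCommGroup M] [AddCommGroup M'] [AddCommGroup A]
    [AddCommGroup A'] [Module R M] [Module R M'] [Module R A] [Module R A'] [Module.Finite R M]
    (hM : Module.IsTorsion R M) (i : M →ₗ[R] M') [IsLocalizedModule (.powers t) i]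
    (j : A →ₗ[R] A') [IsLocalizedModule (.powers t) j] (δ : M' →ₗ[R] A') :
    ∃ h : M →ₗ[R] A, j ∘ₗ h = δ ∘ₗ i := by
  obtain ⟨d, hd, hd0⟩ := Submodule.annihilator_top_inter_nonZeroDivisors hM
  -- The factor `a` divides a power of `t`, so it becomes invertible in `M'`. There `q`, which is
  -- coprime to `t`, already annihilates the image of `M`.
  obtain ⟨a, q, rfl, ⟨n, b, hb⟩, hq⟩ := exists_dvd_pow_mul_isCoprime t (nonZeroDivisors.ne_zero hd0)
  have hqi (x : M) : q • i x = 0 := by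
    have hinj := IsLocalizedModule.smul_injective i
      (⟨t ^ n, Submonoid.pow_mem _ (Submonoid.mem_powers t) n⟩ : Submonoid.powers t)
    apply hinj
    change t ^ n • q • i x = t ^ n • (0 : M')
    rw [smul_zero, ← mul_smul, ← map_smul, hb,
      show a * b * q = b * (a * q) by ring, mul_smul,
      (Submodule.mem_annihilator.1 hd) x trivial, smul_zero, map_zero]
  have : Module.FinitePresentation R M := Module.finitePresentation_of_finite R M
  obtain ⟨h, ⟨_, N, rfl⟩, hh⟩ := Module.FinitePresentation.exists_lift_of_isLocalizedModule
    (.powers t) j (δ ∘ₗ i)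
  -- The lift `h` induces `t ^ N • δ`, not `δ`. As `q` acts by zero, the Bézout coefficient `v`
  -- inverts `t ^ N`.
  obtain ⟨u, v, huv⟩ := hq.pow_right (n := N)
  refine ⟨v • h, LinearMap.ext fun x ↦ ?_⟩
  have h1 : j (h x) = t ^ N • δ (i x) := LinearMap.congr_fun hh x
  calc j (v • h x) = (v * t ^ N) • δ (i x) := by rw [map_smul, h1, mul_smul]
    _ = (u * q + v * t ^ N) • δ (i x) := by
      rw [add_smul, mul_smul u, ← map_smul δ q, hqi, map_zero, smul_zero, zero_add]
    _ = δ (i x) := by rw [huv, one_smul]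

/-! ### Tensor products under base change and localization -/

section BaseChange

variable (S : Type*) [CommRing S] [Algebra R S] (Y : Type*) [AddCommGroup Y] [Module R Y]
  [Module S Y] [IsScalarTower R S Y] {A A' : Type*} [AddCommGroup A] [AddCommGroup A'] [Module R A]
  [Module R A'] [Module S A'] [IsScalarTower R S A']

/-- `Y ⊗[R] A ≃ Y ⊗[S] A'` when `A'` is the base change of `A` to `S`. -/
def IsBaseChange.equivTensorCancel {ι : A →ₗ[R] A'} (h : IsBaseChange S ι) :
    Y ⊗[R] A ≃ₗ[S] Y ⊗[S] A' :=
  (TensorProduct.AlgebraTensorModule.cancelBaseChange R S S Y A).symm ≪≫ₗ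
    TensorProduct.AlgebraTensorModule.congr (LinearEquiv.refl S Y) h.equiv

@[simp]
theorem IsBaseChange.equivTensorCancel_tmul {ι : A →ₗ[R] A'} (h : IsBaseChange S ι) (y : Y) (a : A) :
    h.equivTensorCancel S Y (y ⊗ₜ a) = y ⊗ₜ ι a := by
  simp [IsBaseChange.equivTensorCancel, IsBaseChange.equiv_tmul]

variable {S Y} in
theorem IsBaseChange.lTensor_injective {B B' : Type*} [AddCommGroup B] [AddCommGroup B']
    [Module R B] [Module R B'] [Module S B'] [IsScalarTower R S B'] {ι : A →ₗ[R] A'}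
    {κ : B →ₗ[R] B'} (hι : IsBaseChange S ι) (hκ : IsBaseChange S κ) {f : A →ₗ[R] B}
    {f' : A' →ₗ[S] B'} (hf : ∀ a, f' (ι a) = κ (f a)) (h : Function.Injective (f.lTensor Y)) :
    Function.Injective (f'.lTensor Y) := by
  have key (x : Y ⊗[R] A) :
      f'.lTensor Y (hι.equivTensorCancel S Y x) = hκ.equivTensorCancel S Y (f.lTensor Y x) := by
    induction x with
    | zero => simp
    | add x y hx hy => simp only [map_add, hx, hy]
    | tmul y a => simp [hf]
  rw [injective_iff_map_eq_zero]
  intro x hx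
  obtain ⟨x, rfl⟩ := (hι.equivTensorCancel S Y).surjective x
  rw [key, LinearEquiv.map_eq_zero_iff] at hx
  rw [h (hx.trans (map_zero _).symm), map_zero]

/-- An element of `T ⊗[R] A` which vanishes in the tensor product of the localizations away from
`r` is killed by a power of `r`. -/
theorem IsLocalizedModule.Away.exists_pow_smul_eq_zero_of_tensor (r : R) (S : Type*) [CommRing S]
    [Algebra R S] [IsLocalization.Away r S] {T T' A A' : Type*} [AddCommGroup T] [AddCommGroup T']
    [AddCommGroup A] [AddCommGroup A'] [Module R T] [Module R A] [Module R T'] [Module S T']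
    [IsScalarTower R S T'] [Module R A'] [Module S A'] [IsScalarTower R S A'] (i : T →ₗ[R] T')
    (j : A →ₗ[R] A') [IsLocalizedModule (.powers r) i] [IsLocalizedModule (.powers r) j]
    (ρ : T ⊗[R] A →+ T' ⊗[S] A') (hρ : ∀ t a, ρ (t ⊗ₜ a) = i t ⊗ₜ j a) {x : T ⊗[R] A}
    (hx : ρ x = 0) : ∃ n : ℕ, r ^ n • x = 0 := by
  have hj : IsBaseChange S j := (isLocalizedModule_iff_isBaseChange (.powers r) S j).1 inferInstance
  have key (x : T ⊗[R] A) : ρ x = hj.equivTensorCancel S T' (i.rTensor A x) := by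
    induction x with
    | zero => simp
    | add x y hx hy => simp only [map_add, hx, hy]
    | tmul y a => simp [hρ]
  rw [key, LinearEquiv.map_eq_zero_iff] at hx
  obtain ⟨⟨_, n, rfl⟩, hn⟩ := (IsLocalizedModule.eq_zero_iff (.powers r)
    (TensorProduct.AlgebraTensorModule.rTensor R A i)).1 hx
  exact ⟨n, hn⟩

end BaseChange

end Algebra

/-! ### Quasicoherence in terms of sections over affine opens -/

namespace AlgebraicGeometry.Scheme.Modules

variable {X : Scheme.{u}} (M : X.Modules)

/-- The sections of `M` over the basic open subsets of `U` are the localizations of the sections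
over `U`. -/
structure IsLocalizingOn (U : X.Opens) : Prop where
  surj (f : Γ(X, U)) (s : Γ(M, X.basicOpen f)) : ∃ (n : ℕ) (t : Γ(M, U)),
    M.presheaf.map (homOfLE (X.basicOpen_le f)).op t =
      X.presheaf.map (homOfLE (X.basicOpen_le f)).op f ^ n • s
  inj (f : Γ(X, U)) (t : Γ(M, U)) :
    M.presheaf.map (homOfLE (X.basicOpen_le f)).op t = 0 → ∃ n : ℕ, f ^ n • t = 0

theorem smul_restrict_fromSpec {U : X.Opens} (hU : IsAffineOpen U) (W : (Spec Γ(X, U)).Opens)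
    (r : Γ(X, U)) (x : Γ(M.restrict hU.fromSpec, W)) :
    (M.restrictAppIso hU.fromSpec W).hom (r • x) =
      (X.presheaf.map (homOfLE ((hU.fromSpec.image_le_opensRange W).trans
        hU.opensRange_fromSpec.le)).op r) • (M.restrictAppIso hU.fromSpec W).hom x := by
  rw [smul_Spec_def, smul_restrictAppIso_hom_apply]
  congr 1
  have h : W ≤ hU.fromSpec ⁻¹ᵁ U := by simp
  have h1 : (Scheme.ΓSpecIso Γ(X, U)).inv ≫ (Spec Γ(X, U)).presheaf.map W.leTop.op =
      hU.fromSpec.appLE U W h := by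
    rw [Scheme.Hom.appLE, hU.fromSpec_app_self, Category.assoc, ← Functor.map_comp]
    rfl
  have h2 := Scheme.Hom.appLE_appIso_inv hU.fromSpec h
  rw [← h1] at h2
  exact congr($(h2).hom r)

theorem isLocalizing_iff_forall_basicOpen {R : CommRingCat.{u}} (N : (Spec R).Modules)
    (D : R → (Spec R).Opens) (hD : ∀ f, D f = PrimeSpectrum.basicOpen f) :
    IsLocalizing (modulesSpecToSheaf.obj N) ↔ ∀ f : R,
      (∀ s : Γ(N, D f), ∃ (n : ℕ) (t : Γ(N, ⊤)), N.presheaf.map (D f).leTop.op t = f ^ n • s) ∧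
      (∀ t : Γ(N, ⊤), N.presheaf.map (D f).leTop.op t = 0 → ∃ n : ℕ, f ^ n • t = 0) := by
  obtain rfl : D = fun f ↦ PrimeSpectrum.basicOpen f := funext hD
  refine forall_congr' fun f ↦ ⟨fun h ↦ ⟨fun s ↦ ?_, fun t ht ↦ ?_⟩, fun h ↦
    IsLocalizedModule.Away.mk_of_addCommGroup ?_ ?_ ?_⟩
  · obtain ⟨⟨t, _, n, rfl⟩, hn⟩ := (h : IsLocalizedModule _ _).surj s
    exact ⟨n, t, hn.symm⟩
  · obtain ⟨⟨_, n, rfl⟩, hn⟩ := (IsLocalizedModule.eq_zero_iff (.powers f)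
      ((modulesSpecToSheaf.obj N).obj.map (PrimeSpectrum.basicOpen f).leTop.op).hom).1 ht
    exact ⟨n, hn⟩
  · exact isUnit_algebraMap_end_of_le_basicOpen f le_rfl
  · intro s
    obtain ⟨n, t, ht⟩ := h.1 s
    exact ⟨n, t, ht.symm⟩
  · exact h.2

theorem presheaf_map_bijective_of_eq {U V : X.Opens} (i : U ⟶ V) (h : V ≤ U) :
    Function.Bijective (M.presheaf.map i.op) := by
  obtain rfl : U = V := le_antisymm i.le h
  rw [Subsingleton.elim i (𝟙 U), op_id, M.presheaf.map_id]
  exact Function.bijective_id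

theorem presheaf_map_comp_apply {U V W : X.Opens} (i : U ⟶ V) (j : V ⟶ W) (x : Γ(M, W)) :
    M.presheaf.map i.op (M.presheaf.map j.op x) = M.presheaf.map (i ≫ j).op x := by
  rw [op_comp, M.presheaf.map_comp_apply]

theorem isLocalizing_restrict_fromSpec_iff {U : X.Opens} (hU : IsAffineOpen U) :
    IsLocalizing (modulesSpecToSheaf.obj (M.restrict hU.fromSpec)) ↔ M.IsLocalizingOn U := by
  set N := M.restrict hU.fromSpec
  let D : Γ(X, U) → (Spec Γ(X, U)).Opens := fun f ↦ PrimeSpectrum.basicOpen f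
  have htop : hU.fromSpec ''ᵁ ⊤ = U := by
    rw [Scheme.Hom.image_top_eq_opensRange, hU.opensRange_fromSpec]
  have hV (f : Γ(X, U)) : hU.fromSpec ''ᵁ D f = X.basicOpen f := hU.fromSpec_image_basicOpen f
  -- The bijections `a` and `b f` identify sections on `Spec` with sections on `X`, compatibly with
  -- scalars and restriction, so both conditions transfer through them.
  let a : Γ(N, ⊤) → Γ(M, U) := fun x ↦
    M.presheaf.map (homOfLE htop.ge).op ((M.restrictAppIso hU.fromSpec ⊤).hom x)
  let b (f : Γ(X, U)) : Γ(N, D f) → Γ(M, X.basicOpen f) := fun x ↦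
    M.presheaf.map (homOfLE (hV f).ge).op ((M.restrictAppIso hU.fromSpec _).hom x)
  have ha : Function.Bijective a :=
    (M.presheaf_map_bijective_of_eq _ htop.le).comp
      (ConcreteCategory.bijective_of_isIso (M.restrictAppIso hU.fromSpec ⊤).hom)
  have hb f : Function.Bijective (b f) :=
    (M.presheaf_map_bijective_of_eq _ (hV f).le).comp
      (ConcreteCategory.bijective_of_isIso (M.restrictAppIso hU.fromSpec _).hom)
  have ha0 : a 0 = 0 := by simp [a]
  have hb0 f : b f 0 = 0 := by simp [b]
  have hsa (r : Γ(X, U)) x : a (r • x) = r • a x := by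
    simp only [a]
    rw [smul_restrict_fromSpec, map_smul, ← X.presheaf.map_comp_apply, ← op_comp]
    congr 1
    exact congr($(X.presheaf.map_id _) r)
  have hsb (f r : Γ(X, U)) x : b f (r • x) =
      X.presheaf.map (homOfLE (X.basicOpen_le f)).op r • b f x := by
    simp only [b]
    rw [smul_restrict_fromSpec, map_smul, ← X.presheaf.map_comp_apply, ← op_comp]
    rfl
  have hab (f : Γ(X, U)) x : b f (N.presheaf.map (D f).leTop.op x) =
        M.presheaf.map (homOfLE (X.basicOpen_le f)).op (a x) := by
    simp only [a, b]
    rw [presheaf_map_comp_apply, map_restrictAppIso_hom_apply]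
    exact presheaf_map_comp_apply ..
  rw [isLocalizing_iff_forall_basicOpen N D fun _ ↦ rfl]
  constructor
  · intro h
    constructor
    · intro f s
      obtain ⟨s, rfl⟩ := (hb f).2 s
      obtain ⟨n, t, ht⟩ := (h f).1 s
      exact ⟨n, a t, by rw [← hab, ← map_pow, ← hsb, ht]⟩
    · intro f t ht
      obtain ⟨t, rfl⟩ := ha.2 t
      rw [← hab, ← hb0] at ht
      obtain ⟨n, hn⟩ := (h f).2 _ ((hb f).1 ht)
      exact ⟨n, by rw [← hsa, ← ha0, hn]⟩
  · intro h f
    constructor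
    · intro s
      obtain ⟨n, t, ht⟩ := h.surj f (b f s)
      obtain ⟨t, rfl⟩ := ha.2 t
      exact ⟨n, t, (hb f).1 (by rw [hab, ht, hsb, map_pow])⟩
    · intro t ht
      obtain ⟨n, hn⟩ := h.inj f (a t) (by rw [← hab, ht, hb0])
      exact ⟨n, ha.1 (by rw [ha0, ← hn, ← hsa])⟩

variable {M} in
theorem isLocalizingOn_of_isQuasicoherent [M.IsQuasicoherent] {U : X.Opens}
    (hU : IsAffineOpen U) : M.IsLocalizingOn U := by
  rw [← M.isLocalizing_restrict_fromSpec_iff hU, ← isIso_fromTildeΓ_iff_isLocalizing]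
  infer_instance

/-- A sheaf of modules is quasicoherent if its sections are localizing on the members of an affine
open cover. -/
theorem isQuasicoherent_of_isLocalizingOn {ι : Type u} (U : ι → X.Opens) (hU : ⨆ i, U i = ⊤)
    (hU' : ∀ i, IsAffineOpen (U i)) (h : ∀ i, M.IsLocalizingOn (U i)) :
    M.IsQuasicoherent := by
  have hP (i : ι) : Nonempty (SheafOfModules.Presentation.{u} (M.over (U i))) := by
    have h1 := (M.isLocalizing_restrict_fromSpec_iff (hU' i)).2 (h i)
    rw [← isIso_fromTildeΓ_iff_isLocalizing] at h1
    -- On `Spec` the module is a tilde, which has a presentation. It is carried to the open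
    -- subscheme along `isoSpec`, then to the over-site along `overEquiv`.
    let N := M.restrict (hU' i).fromSpec
    have : IsIso (fromTildeΓ (R := Γ(X, U i)) N) := h1
    let P₁ : SheafOfModules.Presentation.{u} N := @SheafOfModules.Presentation.ofIsIso _ _ _ _ _ _ _ _
      (fromTildeΓ (R := Γ(X, U i)) N) this (presentationTilde.{u} _ .univ (by simp) _ (Submodule.span_eq _))
    let P₂ := presentationRestrict (hU' i).isoSpec.hom P₁
    let e : restrictFunctor (hU' i).fromSpec ⋙ restrictFunctor (hU' i).isoSpec.hom ≅
        SheafOfModules.overFunctor X.ringCatSheaf (U i) ⋙ (overEquiv (U i)).functor :=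
      (restrictFunctorComp _ _).symm ≪≫ restrictFunctorCongr (hU' i).isoSpec_hom_fromSpec ≪≫
        (overFunctorEquiv (U i)).symm
    let P₃ := @SheafOfModules.Presentation.ofIsIso.{u, u, u} _ _ _ _ _ _ _ _ (e.app M).hom
      (e.app M).isIso_hom P₂
    have hpres : Limits.PreservesColimitsOfSize.{u, u} (overEquiv (U i)).inverse :=
      (overEquiv (U i)).symm.toAdjunction.leftAdjoint_preservesColimits
    let η₀ : SheafOfModules.unit (X.ringCatSheaf.over (U i)) ≅
        (SheafOfModules.overFunctor X.ringCatSheaf (U i)).obj (SheafOfModules.unit _) := Iso.refl _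
    let η : (overEquiv (U i)).functor.obj (SheafOfModules.unit _) ≅
        SheafOfModules.unit (U i).toScheme.ringCatSheaf :=
      (overEquiv (U i)).functor.mapIso η₀ ≪≫ (overFunctorEquiv (U i)).app _ ≪≫
        restrictUnitIso (U i).ι
    let P₄ := @SheafOfModules.Presentation.map _ _ _ _ _ _ _ _ _ _ _ _ _ P₃
      (overEquiv (U i)).inverse hpres ((overEquiv (U i)).unitIso.app (SheafOfModules.unit _) ≪≫
        (overEquiv (U i)).inverse.mapIso η)
    let e' := (overEquiv (U i)).unitIso.symm.app (SheafOfModules.over M (U i))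
    exact ⟨P₄.ofIsIso e'.hom⟩
  exact SheafOfModules.QuasicoherentData.isQuasicoherent (M := M)
    { I := ι
      X := U
      coversTop := (Opens.coversTop_iff _ _).2 hU
      presentation := fun i ↦ (hP i).some }

theorem epi_tilde_map_moduleSpecΓFunctor_map {R : CommRingCat.{u}} {M N : (Spec (.of R)).Modules}
    [M.IsQuasicoherent] [N.IsQuasicoherent] (φ : M ⟶ N) [Epi φ] :
    Epi ((tilde.functor R).map (moduleSpecΓFunctor.map φ)) := by
  have h := (fromTildeΓNatTrans (R := R)).naturality φ
  have hM : IsIso (fromTildeΓNatTrans.app M) := isIso_fromTildeΓ_of_isQuasicoherent (R := R) M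
  have hN : IsIso (fromTildeΓNatTrans.app N) := isIso_fromTildeΓ_of_isQuasicoherent (R := R) N
  rw [← IsIso.eq_comp_inv] at h
  have : Epi ((moduleSpecΓFunctor (R := R) ⋙ tilde.functor (R := R)).map φ) := by
    rw [h]
    have : Epi ((𝟭 _ : (Spec (.of R)).Modules ⥤ _).map φ) := ‹Epi φ›
    infer_instance
  exact this

/-- On an affine open both sheaves are tildes, so the epimorphism is the tilde of its map on global
sections. The tilde functor reflects epimorphisms, so no cohomology is needed. -/
theorem app_surjective_of_epi {M N : X.Modules} (φ : M ⟶ N) [Epi φ]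
    [M.IsQuasicoherent] [N.IsQuasicoherent]
    {U : X.Opens} (hU : IsAffineOpen U) : Function.Surjective (φ.app U) := by
  let F := restrictFunctor hU.fromSpec
  have h1 : Epi (F.map φ) := inferInstance
  have h2 : Epi ((tilde.functor _).map (moduleSpecΓFunctor.map (F.map φ))) :=
    epi_tilde_map_moduleSpecΓFunctor_map _
  have h3 : Epi (moduleSpecΓFunctor.map (F.map φ)) :=
    (tilde.functor _).epi_of_epi_map h2
  rw [ModuleCat.epi_iff_surjective] at h3
  have h4 : Function.Surjective (φ.app (hU.fromSpec ''ᵁ ⊤)) := h3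
  rwa [Scheme.Hom.image_top_eq_opensRange, hU.opensRange_fromSpec] at h4

/-! ### Restriction maps as linear maps -/

section Restriction

variable {U V : X.Opens} (h : V ≤ U)

/-- Sections over `V ≤ U` as an algebra over the sections over `U`. -/
abbrev algebraOfLE : Algebra Γ(X, U) Γ(X, V) :=
  (X.presheaf.map (homOfLE h).op).hom.toAlgebra

/-- Sections of `M` over `V ≤ U` as a module over the sections of `𝒪_X` over `U`. -/
abbrev moduleOfLE : Module Γ(X, U) Γ(M, V) :=
  Module.compHom _ (X.presheaf.map (homOfLE h).op).hom

theorem isScalarTower_of_le :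
    letI := algebraOfLE h
    letI := M.moduleOfLE h
    IsScalarTower Γ(X, U) Γ(X, V) Γ(M, V) :=
  letI := algebraOfLE h
  letI := M.moduleOfLE h
  .of_algebraMap_smul fun _ _ ↦ rfl

/-- The restriction map on sections of `M` as a linear map. -/
def resₗ : letI := M.moduleOfLE h; Γ(M, U) →ₗ[Γ(X, U)] Γ(M, V) :=
  letI := M.moduleOfLE h
  { toFun := M.presheaf.map (homOfLE h).op
    map_add' := map_add _
    map_smul' := fun r x ↦ M.map_smul (homOfLE h) r x }

theorem resₗ_apply (x : Γ(M, U)) :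
    letI := M.moduleOfLE h
    M.resₗ h x = M.presheaf.map (homOfLE h).op x := rfl

/-- The action of a morphism on sections, as a linear map. -/
def Hom.appₗ {M N : X.Modules} (φ : M ⟶ N) (U : X.Opens) : Γ(M, U) →ₗ[Γ(X, U)] Γ(N, U) where
  toFun := φ.app U
  map_add' := map_add _
  map_smul' := Hom.app_smul φ

@[simp]
theorem Hom.appₗ_apply {M N : X.Modules} (φ : M ⟶ N) (U : X.Opens) (x : Γ(M, U)) :
    φ.appₗ U x = φ.app U x := rfl

theorem app_map_apply {M N : X.Modules} (φ : M ⟶ N) {U V : X.Opens} (i : V ⟶ U) (x : Γ(M, U)) :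
    φ.app V (M.presheaf.map i.op x) = N.presheaf.map i.op (φ.app U x) :=
  congr($(φ.mapPresheaf.naturality i.op) x)

-- The open `V` is only assumed equal to a basic open, so that the overlap of two charts can be used
-- as a basic open of either.
variable {M} in
theorem IsLocalizingOn.isLocalizedModule (hM : M.IsLocalizingOn U) {f : Γ(X, U)}
    (hV : V = X.basicOpen f) :
    letI := M.moduleOfLE h
    IsLocalizedModule (.powers f) (M.resₗ h) := by
  subst hV
  let _ := M.moduleOfLE h
  refine IsLocalizedModule.Away.mk_of_addCommGroup ?_ ?_ ?_
  · have hu : IsUnit (X.presheaf.map (homOfLE h).op f) := by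
      have := X.toRingedSpace.isUnit_res_basicOpen f
      exact this
    exact hu.map (algebraMap Γ(X, X.basicOpen f) (Module.End Γ(X, X.basicOpen f)
      Γ(M, X.basicOpen f))) |> fun hu ↦ by
        rw [Module.End.isUnit_iff] at hu ⊢
        exact hu
  · intro s
    obtain ⟨n, t, ht⟩ := hM.surj f s
    refine ⟨n, t, ?_⟩
    rw [resₗ_apply, ht, ← map_pow]
    rfl
  · exact hM.inj f

end Restriction

end AlgebraicGeometry.Scheme.Modules

/-! ### Sheafification and sheaf tensor products tested on a basis -/

namespace AlgebraicGeometry.Scheme.Modules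

variable {X : Scheme.{u}}

theorem exists_mem_basis_le {𝓑 : Set X.Opens} (h𝓑 : TopologicalSpace.Opens.IsBasis 𝓑)
    {U : X.Opens} {x : X} (hx : x ∈ U) : ∃ V ∈ 𝓑, V ≤ U ∧ x ∈ V := by
  obtain ⟨_, ⟨V, hV, rfl⟩, hxV, hVU⟩ := h𝓑.exists_subset_of_mem_open hx U.2
  exact ⟨V, hV, hVU, hxV⟩

theorem section_ext_of_isBasis (M : X.Modules) {𝓑 : Set X.Opens}
    (h𝓑 : TopologicalSpace.Opens.IsBasis 𝓑) {U : X.Opens} {s t : Γ(M, U)}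
    (h : ∀ V ∈ 𝓑, ∀ i : V ⟶ U, M.presheaf.map i.op s = M.presheaf.map i.op t) : s = t := by
  refine TopCat.Presheaf.IsSheaf.section_ext M.isSheaf fun x hx ↦ ?_
  obtain ⟨V, hV, hVU, hxV⟩ := exists_mem_basis_le h𝓑 hx
  exact ⟨V, hVU, hxV, h V hV (homOfLE hVU)⟩

/-- A presheaf of modules which vanishes on a basis has zero sheafification. -/
theorem isZero_sheafification_of_isBasis (P : X.PresheafOfModules) {𝓑 : Set X.Opens}
    (h𝓑 : TopologicalSpace.Opens.IsBasis 𝓑) (hP : ∀ V ∈ 𝓑, ∀ x : P.obj (op V), x = 0) :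
    Limits.IsZero ((PresheafOfModules.sheafification (𝟙 X.ringCatSheaf.obj)).obj P) := by
  rw [Limits.IsZero.iff_id_eq_zero]
  -- By adjunction it suffices that any two maps from `P` to its sheafification agree. After
  -- restriction to the basis both factor through zero.
  apply ((PresheafOfModules.sheafificationAdjunction (𝟙 X.ringCatSheaf.obj)).homEquiv _ _).injective
  generalize ((PresheafOfModules.sheafificationAdjunction (𝟙 X.ringCatSheaf.obj)).homEquiv _ _)
    (𝟙 ((PresheafOfModules.sheafification (𝟙 X.ringCatSheaf.obj)).obj P)) = f
  generalize ((PresheafOfModules.sheafificationAdjunction (𝟙 X.ringCatSheaf.obj)).homEquiv _ _)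
    (0 : (PresheafOfModules.sheafification (𝟙 X.ringCatSheaf.obj)).obj P ⟶ _) = g
  ext U x
  refine section_ext_of_isBasis (U := U.unop)
    ((PresheafOfModules.sheafification (𝟙 X.ringCatSheaf.obj)).obj P) h𝓑 fun V hV i ↦ ?_
  have hf := PresheafOfModules.naturality_apply f i.op x
  have hg := PresheafOfModules.naturality_apply g i.op x
  rw [hP V hV (P.map i.op x), map_zero] at hf hg
  exact hf.symm.trans hg

/-- Sheafification commutes with homology, so the homology is the sheafification of a presheaf that
vanishes on the basis. -/
theorem exact_map_sheafification (T : ShortComplex X.PresheafOfModules) {𝓑 : Set X.Opens}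
    (h𝓑 : TopologicalSpace.Opens.IsBasis 𝓑)
    (hT : ∀ V ∈ 𝓑, (T.map (PresheafOfModules.evaluation _ (op V))).Exact) :
    (T.map (PresheafOfModules.sheafification (𝟙 X.ringCatSheaf.obj))).Exact := by
  rw [ShortComplex.exact_iff_isZero_homology]
  refine Limits.IsZero.of_iso (isZero_sheafification_of_isBasis T.homology h𝓑 fun V hV x ↦ ?_)
    (T.mapHomologyIso (PresheafOfModules.sheafification (𝟙 X.ringCatSheaf.obj)))
  have h := ((ShortComplex.exact_iff_isZero_homology _).1 (hT V hV)).of_iso (T.mapHomologyIso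
    (PresheafOfModules.evaluation _ (op V))).symm
  have := ModuleCat.subsingleton_of_isZero h
  exact Subsingleton.elim (α := ((PresheafOfModules.evaluation _ (op V)).obj T.homology)) x 0

theorem mono_map_sheafification {P Q : X.PresheafOfModules} (f : P ⟶ Q) {𝓑 : Set X.Opens}
    (h𝓑 : TopologicalSpace.Opens.IsBasis 𝓑)
    (hf : ∀ V ∈ 𝓑, Function.Injective (f.app (op V))) :
    Mono ((PresheafOfModules.sheafification (𝟙 X.ringCatSheaf.obj)).map f) := by
  let T : ShortComplex X.PresheafOfModules := ShortComplex.mk (0 : P ⟶ P) f Limits.zero_comp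
  have h := exact_map_sheafification T h𝓑 fun V hV ↦ by
    rw [ShortComplex.exact_iff_mono _ (by simp [T]; rfl)]
    exact (ModuleCat.mono_iff_injective _).2 (hf V hV)
  rwa [ShortComplex.exact_iff_mono _ (by simp [T]; rfl)] at h

theorem epi_map_sheafification {P Q : X.PresheafOfModules} (f : P ⟶ Q) {𝓑 : Set X.Opens}
    (h𝓑 : TopologicalSpace.Opens.IsBasis 𝓑)
    (hf : ∀ V ∈ 𝓑, Function.Surjective (f.app (op V))) :
    Epi ((PresheafOfModules.sheafification (𝟙 X.ringCatSheaf.obj)).map f) := by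
  let T : ShortComplex X.PresheafOfModules := ShortComplex.mk f (0 : Q ⟶ Q) Limits.comp_zero
  have h := exact_map_sheafification T h𝓑 fun V hV ↦ by
    rw [ShortComplex.exact_iff_epi _ (by simp [T]; rfl)]
    exact (ModuleCat.epi_iff_surjective _).2 (hf V hV)
  rwa [ShortComplex.exact_iff_epi _ (by simp [T]; rfl)] at h

-- Right exactness of the tensor product is automatic on each basic open; injectivity on the left is
-- the only condition involving `Y`.
open GPure in
theorem shortExact_map_sheafTensor (S : ShortComplex X.Modules) (Y : X.Modules) {𝓑 : Set X.Opens}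
    (h𝓑 : TopologicalSpace.Opens.IsBasis 𝓑)
    (hinj : ∀ V ∈ 𝓑, Function.Injective ((S.f.appₗ V).lTensor Γ(Y, V)))
    (hexact : ∀ V ∈ 𝓑, Function.Exact (S.f.appₗ V) (S.g.appₗ V))
    (hsurj : ∀ V ∈ 𝓑, Function.Surjective (S.g.app V)) :
    (S.map (sheafTensor Y)).ShortExact := by
  let T : ShortComplex X.PresheafOfModules := (S.map (Scheme.Modules.toPresheafOfModules X)).map
    (presheafTensor ((Scheme.Modules.toPresheafOfModules X).obj Y))
  have hS : S.map (sheafTensor Y) =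
    T.map (PresheafOfModules.sheafification (𝟙 X.ringCatSheaf.obj)) := rfl
  have hsurj' (V) (hV : V ∈ 𝓑) : Function.Surjective ((S.g.appₗ V).lTensor Γ(Y, V)) :=
    LinearMap.lTensor_surjective _ (hsurj V hV)
  have hexact' (V) (hV : V ∈ 𝓑) := lTensor_exact Γ(Y, V) (hexact V hV) (hsurj V hV)
  rw [hS]
  exact
    { exact := exact_map_sheafification T h𝓑 fun V hV ↦ by
        rw [ShortComplex.moduleCat_exact_iff]
        exact fun x hx ↦ (hexact' V hV x).1 hx
      mono_f := mono_map_sheafification T.f h𝓑 fun V hV ↦ hinj V hV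
      epi_g := epi_map_sheafification T.g h𝓑 fun V hV ↦ hsurj' V hV }

theorem app_injective_of_mono {M N : X.Modules} (φ : M ⟶ N) [Mono φ] (U : X.Opens) :
    Function.Injective (φ.app U) := by
  have h : Mono ((toPresheaf X).map φ) := inferInstance
  rw [NatTrans.mono_iff_mono_app] at h
  exact (AddCommGrpCat.mono_iff_injective _).1 (h (op U))

/-- A section of a presheaf of modules which vanishes in the sheafification vanishes locally. -/
theorem exists_map_eq_zero_of_sheafification (P : X.PresheafOfModules) {U : X.Opens}
    (x : P.obj (op U)) (hx : ((PresheafOfModules.sheafificationAdjunction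
      (𝟙 X.ringCatSheaf.obj)).unit.app P).app (op U) x = 0) {y : X} (hy : y ∈ U) :
    ∃ (V : X.Opens) (i : V ⟶ U), y ∈ V ∧ P.map i.op x = 0 := by
  have h := Presheaf.equalizerSieve_mem (Opens.grothendieckTopology X)
    (CategoryTheory.toSheafify (Opens.grothendieckTopology X) P.presheaf) (X := op U) x 0
    (by rw [map_zero]; exact hx)
  obtain ⟨V, i, hi, hyV⟩ := h y hy
  refine ⟨V, i, hyV, ?_⟩
  have h2 : P.presheaf.map i.op x = P.presheaf.map i.op 0 := hi
  exact h2.trans (map_zero _)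

-- The presheaf tensor product need not be a sheaf. However, a section `x` in the kernel dies after
-- sheafification, so it vanishes on basic opens covering `U`. By quasicoherence each such `f`
-- satisfies `f ^ n • x = 0`, and since these `f` generate the unit ideal, `x = 0`.
open GPure TensorProduct in
theorem lTensor_injective_of_mono_map_sheafTensor (T : X.Modules) {M N : X.Modules} (φ : M ⟶ N)
    [T.IsQuasicoherent] [M.IsQuasicoherent] [Mono ((sheafTensor T).map φ)] {U : X.Opens}
    (hU : IsAffineOpen U) : Function.Injective ((φ.appₗ U).lTensor Γ(T, U)) := by
  rw [injective_iff_map_eq_zero]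
  intro x hx
  let P (M : X.Modules) : X.PresheafOfModules :=
    (presheafTensor ((toPresheafOfModules X).obj T)).obj ((toPresheafOfModules X).obj M)
  let η (M : X.Modules) := (PresheafOfModules.sheafificationAdjunction
    (𝟙 X.ringCatSheaf.obj)).unit.app (P M)
  have hη : (η M).app (op U) x = 0 := by
    apply app_injective_of_mono ((sheafTensor T).map φ) U
    let ψ : P M ⟶ P N :=
      (presheafTensor ((toPresheafOfModules X).obj T)).map ((toPresheafOfModules X).map φ)
    have h1 : ψ ≫ η N = η M ≫ (SheafOfModules.forget X.ringCatSheaf ⋙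
        PresheafOfModules.restrictScalars (𝟙 X.ringCatSheaf.obj)).map
          ((PresheafOfModules.sheafification (𝟙 X.ringCatSheaf.obj)).map ψ) :=
      (PresheafOfModules.sheafificationAdjunction (𝟙 X.ringCatSheaf.obj)).unit.naturality ψ
    have h2 := congr((($h1).app (op U)).hom x)
    have h3 : (ψ.app (op U)).hom x = 0 := hx
    have h4 : ((η N).app (op U)).hom ((ψ.app (op U)).hom x) = 0 := by
      rw [h3]; exact map_zero _
    exact (h2.symm.trans h4).trans (map_zero (((sheafTensor T).map φ).app U).hom).symm
  have hloc (y : X) (hy : y ∈ U) : ∃ f : Γ(X, U), y ∈ X.basicOpen f ∧ ∃ n : ℕ, f ^ n • x = 0 := by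
    obtain ⟨V, i, hyV, hV⟩ := exists_map_eq_zero_of_sheafification (P M) x hη hy
    obtain ⟨f, hfV, hyf⟩ := hU.exists_basicOpen_le ⟨y, hyV⟩ hy
    refine ⟨f, hyf, ?_⟩
    let W := X.basicOpen f
    have hW : W ≤ U := X.basicOpen_le f
    have hWx : (P M).map (homOfLE hW).op x = 0 := by
      have := PresheafOfModules.map_comp_apply (P M) i.op (homOfLE hfV).op x
      rw [hV] at this
      exact this.trans (map_zero ((P M).map (homOfLE hfV).op).hom)
    let ρ : Γ(T, U) ⊗[Γ(X, U)] Γ(M, U) →+ Γ(T, W) ⊗[Γ(X, W)] Γ(M, W) :=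
      ((P M).map (homOfLE hW).op).hom.toAddMonoidHom
    let _ := algebraOfLE hW
    let _ := T.moduleOfLE hW
    let _ := M.moduleOfLE hW
    have := T.isScalarTower_of_le hW
    have := M.isScalarTower_of_le hW
    have h1 : IsLocalizedModule (.powers f) (T.resₗ hW) :=
      (isLocalizingOn_of_isQuasicoherent hU).isLocalizedModule hW rfl
    have h2 : IsLocalizedModule (.powers f) (M.resₗ hW) :=
      (isLocalizingOn_of_isQuasicoherent hU).isLocalizedModule hW rfl
    have h3 : IsLocalization.Away f Γ(X, W) := hU.isLocalization_basicOpen f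
    refine IsLocalizedModule.Away.exists_pow_smul_eq_zero_of_tensor f Γ(X, W) (T.resₗ hW)
      (M.resₗ hW) ρ (fun t a ↦ ?_) hWx
    rfl
  let s : Set Γ(X, U) := {f | ∃ n : ℕ, f ^ n • x = 0}
  have hs : Ideal.span s = ⊤ := by
    rw [← hU.self_le_iSup_basicOpen_iff]
    intro y hy
    obtain ⟨f, hyf, hf⟩ := hloc y hy
    exact TopologicalSpace.Opens.mem_iSup.2 ⟨⟨f, hf⟩, hyf⟩
  let I := Ideal.torsionOf Γ(X, U) _ x
  have hsI : Ideal.span s ≤ I.radical :=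
    Ideal.span_le.2 fun f ⟨n, hn⟩ ↦ ⟨n, (Ideal.mem_torsionOf_iff _ _).2 hn⟩
  have hI : I = ⊤ := Ideal.radical_eq_top.1 (top_le_iff.1 (hs ▸ hsI))
  have := (Ideal.mem_torsionOf_iff x (1 : Γ(X, U))).1 (by
    change (1 : Γ(X, U)) ∈ I
    rw [hI]
    exact Submodule.mem_top)
  rwa [one_smul] at this

end AlgebraicGeometry.Scheme.Modules

/-! ### Gluing morphisms from two affine opens -/

namespace AlgebraicGeometry.Scheme.Modules

variable {X : Scheme.{u}}

/-- A compatible family of linear maps on the members of a basis comes from a morphism. -/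
theorem exists_hom_of_isBasis (M N : X.Modules) {𝓑 : Set X.Opens}
    (h𝓑 : TopologicalSpace.Opens.IsBasis 𝓑) (f : ∀ V : 𝓑, Γ(M, V.1) →ₗ[Γ(X, V.1)] Γ(N, V.1))
    (hf : ∀ (V W : 𝓑) (i : V.1 ⟶ W.1) (x : Γ(M, W.1)),
      f V (M.presheaf.map i.op x) = N.presheaf.map i.op (f W x)) :
    ∃ φ : M ⟶ N, ∀ (V : 𝓑) (x : Γ(M, V.1)), φ.app V.1 x = f V x := by
  have hB : TopologicalSpace.Opens.IsBasis (Set.range (Subtype.val : 𝓑 → X.Opens)) := by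
    rwa [Subtype.range_coe]
  let α : (inducedFunctor (Subtype.val : 𝓑 → X.Opens)).op ⋙ M.presheaf ⟶
      (inducedFunctor (Subtype.val : 𝓑 → X.Opens)).op ⋙ N.presheaf :=
    { app := fun V ↦ AddCommGrpCat.ofHom (f V.unop).toAddMonoidHom
      naturality := fun V W i ↦ by
        ext x
        exact hf W.unop V.unop ((inducedFunctor (Subtype.val : 𝓑 → X.Opens)).map i.unop) x }
  let β : M.presheaf ⟶ N.presheaf :=
    TopCat.Sheaf.restrictHomEquivHom M.presheaf ⟨N.presheaf, N.isSheaf⟩ hB α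
  have hβ (V : 𝓑) (x : Γ(M, V.1)) : β.app (op V.1) x = f V x :=
    congr($(TopCat.Sheaf.extend_hom_app M.presheaf ⟨N.presheaf, N.isSheaf⟩ hB α V) x)
  have hβn {U V : X.Opens} (i : V ⟶ U) (x : Γ(M, U)) :
      N.presheaf.map i.op (β.app (op U) x) = β.app (op V) (M.presheaf.map i.op x) :=
    congr($(β.naturality i.op) x).symm
  have hsmul (U : X.Opens) (r : Γ(X, U)) (m : Γ(M, U)) :
      (β.app (op U) (r • m) : Γ(N, U)) = r • (β.app (op U) m : Γ(N, U)) := by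
    refine N.section_ext_of_isBasis h𝓑 fun V hV i ↦ ?_
    rw [hβn i, map_smul, map_smul, hβn i, hβ ⟨V, hV⟩, hβ ⟨V, hV⟩]
    exact (f ⟨V, hV⟩).map_smul _ _
  exact ⟨⟨PresheafOfModules.homMk (M₁ := M.val) (M₂ := N.val) β fun U ↦ hsmul U.unop⟩, hβ⟩

/-- Up to units, the sections of `M` over `V` come from sections over `U`. -/
def RestrictsOnto (M : X.Modules) {U V : X.Opens} (i : V ⟶ U) : Prop :=
  ∀ x : Γ(M, V), ∃ (r : Γ(X, V)) (y : Γ(M, U)), IsUnit r ∧ M.presheaf.map i.op y = r • x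

theorem isUnit_map_of_le_basicOpen {U V : X.Opens} (i : V ⟶ U) {f : Γ(X, U)}
    (hV : V ≤ X.basicOpen f) : IsUnit (X.presheaf.map i.op f) := by
  have h : IsUnit (X.presheaf.map (homOfLE (X.basicOpen_le f)).op f) :=
    X.toRingedSpace.isUnit_res_basicOpen f
  have := h.map (X.presheaf.map (homOfLE hV).op).hom
  rw [← X.presheaf.map_comp_apply] at this
  exact this

theorem IsLocalizingOn.restrictsOnto {M : X.Modules} {U V : X.Opens} (hM : M.IsLocalizingOn U)
    {f : Γ(X, U)} (hV : V = X.basicOpen f) (i : V ⟶ U) : M.RestrictsOnto i := by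
  subst hV
  intro x
  obtain ⟨n, t, ht⟩ := hM.surj f x
  exact ⟨_, t, (isUnit_map_of_le_basicOpen i le_rfl).pow n, ht⟩

theorem IsLocalizingOn.exists_linearMap {M N : X.Modules} {U V : X.Opens}
    (hM : M.IsLocalizingOn U) (hN : N.IsLocalizingOn U) {f : Γ(X, U)} (hU : IsAffineOpen U)
    (hV : V = X.basicOpen f)
    (g : Γ(M, U) →ₗ[Γ(X, U)] Γ(N, U)) (i : V ⟶ U) : ∃ g' : Γ(M, V) →ₗ[Γ(X, V)] Γ(N, V),
      ∀ x, g' (M.presheaf.map i.op x) = N.presheaf.map i.op (g x) := by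
  let _ := algebraOfLE i.le
  let _ := M.moduleOfLE i.le
  let _ := N.moduleOfLE i.le
  have := M.isScalarTower_of_le i.le
  have := N.isScalarTower_of_le i.le
  have h1 := hM.isLocalizedModule i.le hV
  have h2 := hN.isLocalizedModule i.le hV
  have h3 : IsLocalization.Away f Γ(X, V) := by
    subst hV
    exact hU.isLocalization_basicOpen f
  refine ⟨(IsLocalizedModule.map (.powers f) (M.resₗ i.le) (N.resₗ i.le)
    g).extendScalarsOfIsLocalization (.powers f) Γ(X, V), fun x ↦ ?_⟩
  exact IsLocalizedModule.map_apply (.powers f) (M.resₗ i.le) (N.resₗ i.le) g x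

/-- Up to a unit factor every section over `V` comes from `U`; linearity and cancellation of the
unit reduce the claim to sections over `U`. -/
theorem RestrictsOnto.apply_map {M N : X.Modules} {U V W : X.Opens} {i : V ⟶ U}
    (hi : M.RestrictsOnto i) (j : W ⟶ V) (a : Γ(M, W) →ₗ[Γ(X, W)] Γ(N, W))
    (b : Γ(M, V) →ₗ[Γ(X, V)] Γ(N, V))
    (h : ∀ y : Γ(M, U), a (M.presheaf.map (j ≫ i).op y) =
      N.presheaf.map j.op (b (M.presheaf.map i.op y))) (x : Γ(M, V)) :
    a (M.presheaf.map j.op x) = N.presheaf.map j.op (b x) := by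
  obtain ⟨r, y, hr, hy⟩ := hi x
  have := h y
  rw [← presheaf_map_comp_apply, hy, M.map_smul, LinearMap.map_smul, LinearMap.map_smul,
    N.map_smul] at this
  exact (hr.map (X.presheaf.map j.op).hom).smul_left_cancel.1 this

theorem isBasis_basicOpen {U₀ U₁ : X.Opens} (hU₀ : IsAffineOpen U₀) (hU₁ : IsAffineOpen U₁)
    (hU : U₀ ⊔ U₁ = ⊤) : TopologicalSpace.Opens.IsBasis
      {V : X.Opens | (∃ r : Γ(X, U₀), V = X.basicOpen r) ∨ ∃ r : Γ(X, U₁), V = X.basicOpen r} := by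
  rw [TopologicalSpace.Opens.isBasis_iff_nbhd]
  intro V x hx
  have hx' : x ∈ U₀ ⊔ U₁ := hU ▸ TopologicalSpace.Opens.mem_top x
  obtain h | h := hx'
  · obtain ⟨f, hf, hxf⟩ := hU₀.exists_basicOpen_le ⟨x, hx⟩ h
    exact ⟨_, .inl ⟨f, rfl⟩, hxf, hf⟩
  · obtain ⟨f, hf, hxf⟩ := hU₁.exists_basicOpen_le ⟨x, hx⟩ h
    exact ⟨_, .inr ⟨f, rfl⟩, hxf, hf⟩

section TwoOpens

variable {M N : X.Modules} {U₀ U₁ U₀₁ : X.Opens} (i₀ : U₀₁ ⟶ U₀) (i₁ : U₀₁ ⟶ U₁)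
  (hU₀₁ : U₀ ⊓ U₁ ≤ U₀₁)
  {f₀ : Γ(M, U₀) →ₗ[Γ(X, U₀)] Γ(N, U₀)} {f₁ : Γ(M, U₁) →ₗ[Γ(X, U₁)] Γ(N, U₁)}
  (h : Γ(M, U₀₁) →ₗ[Γ(X, U₀₁)] Γ(N, U₀₁))
  (h₀ : ∀ x, h (M.presheaf.map i₀.op x) = N.presheaf.map i₀.op (f₀ x))
  (h₁ : ∀ x, h (M.presheaf.map i₁.op x) = N.presheaf.map i₁.op (f₁ x))

-- The map `g` is the localization of `f₀`. If the basic open also lies in `U₁` it lies in the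
-- overlap, where `h` ties `f₀` to `f₁`.
include hU₀₁ h₀ h₁ in
theorem exists_linearMap_basicOpen (hU₀ : IsAffineOpen U₀)
    (hM₀ : M.IsLocalizingOn U₀) (hN₀ : N.IsLocalizingOn U₀) (hM : M.RestrictsOnto i₀)
    (r : Γ(X, U₀)) : ∃ g : Γ(M, X.basicOpen r) →ₗ[Γ(X, X.basicOpen r)] Γ(N, X.basicOpen r),
      (∀ (i : X.basicOpen r ⟶ U₀) x, g (M.presheaf.map i.op x) = N.presheaf.map i.op (f₀ x)) ∧
      (∀ (i : X.basicOpen r ⟶ U₁) x, g (M.presheaf.map i.op x) = N.presheaf.map i.op (f₁ x)) := by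
  obtain ⟨g, hg⟩ := hM₀.exists_linearMap hN₀ hU₀ rfl f₀ (homOfLE (X.basicOpen_le r))
  refine ⟨g, fun i x ↦ hg x, fun i x ↦ ?_⟩
  have hle : X.basicOpen r ≤ U₀₁ := (le_inf (X.basicOpen_le r) i.le).trans hU₀₁
  have h2 := hM.apply_map (homOfLE hle) g h
    (fun y ↦ by
      rw [h₀, presheaf_map_comp_apply]
      exact hg y) (M.presheaf.map i₁.op x)
  rw [h₁, presheaf_map_comp_apply, presheaf_map_comp_apply] at h2
  exact h2

-- The map `h` on the overlap witnesses that `f₀` and `f₁` agree there. Localizing them gives a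
-- compatible family on the basis of basic opens of either chart.
include hU₀₁ h₀ h₁ in
theorem exists_hom_of_two_opens (hU₀ : IsAffineOpen U₀) (hU₁ : IsAffineOpen U₁)
    (hU : U₀ ⊔ U₁ = ⊤) (hM₀ : M.IsLocalizingOn U₀) (hN₀ : N.IsLocalizingOn U₀)
    (hM₁ : M.IsLocalizingOn U₁) (hN₁ : N.IsLocalizingOn U₁)
    (hi₀ : M.RestrictsOnto i₀) (hi₁ : M.RestrictsOnto i₁) :
    ∃ φ : M ⟶ N, φ.appₗ U₀ = f₀ ∧ φ.appₗ U₁ = f₁ := by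
  let 𝓑 : Set X.Opens := {V | (∃ r : Γ(X, U₀), V = X.basicOpen r) ∨
    ∃ r : Γ(X, U₁), V = X.basicOpen r}
  have h𝓑 : TopologicalSpace.Opens.IsBasis 𝓑 := isBasis_basicOpen hU₀ hU₁ hU
  have hex (V : 𝓑) : ∃ g : Γ(M, V.1) →ₗ[Γ(X, V.1)] Γ(N, V.1),
      (∀ (i : V.1 ⟶ U₀) x, g (M.presheaf.map i.op x) = N.presheaf.map i.op (f₀ x)) ∧
      (∀ (i : V.1 ⟶ U₁) x, g (M.presheaf.map i.op x) = N.presheaf.map i.op (f₁ x)) := by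
    obtain ⟨V, ⟨r, rfl⟩ | ⟨r, rfl⟩⟩ := V
    · exact exists_linearMap_basicOpen i₀ i₁ hU₀₁ h h₀ h₁ hU₀ hM₀ hN₀ hi₀ r
    · obtain ⟨g, hg⟩ := exists_linearMap_basicOpen i₁ i₀ (inf_comm U₀ U₁ ▸ hU₀₁) h h₁ h₀ hU₁ hM₁
        hN₁ hi₁ r
      exact ⟨g, hg.2, hg.1⟩
  choose g hg₀ hg₁ using hex
  obtain ⟨φ, hφ⟩ := exists_hom_of_isBasis M N h𝓑 g fun V W j x ↦ by
    obtain ⟨W, ⟨r, rfl⟩ | ⟨r, rfl⟩⟩ := W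
    · refine (hM₀.restrictsOnto rfl (homOfLE (X.basicOpen_le r))).apply_map j (g V) (g ⟨_, .inl ⟨r, rfl⟩⟩)
        (fun y ↦ ?_) x
      rw [hg₀, hg₀, presheaf_map_comp_apply]
    · refine (hM₁.restrictsOnto rfl (homOfLE (X.basicOpen_le r))).apply_map j (g V) (g ⟨_, .inr ⟨r, rfl⟩⟩)
        (fun y ↦ ?_) x
      rw [hg₁, hg₁, presheaf_map_comp_apply]
  refine ⟨φ, LinearMap.ext fun x ↦ ?_, LinearMap.ext fun x ↦ ?_⟩
  · refine N.section_ext_of_isBasis h𝓑 fun V hV i ↦ ?_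
    rw [Hom.appₗ_apply, ← app_map_apply, hφ ⟨V, hV⟩, hg₀]
  · refine N.section_ext_of_isBasis h𝓑 fun V hV i ↦ ?_
    rw [Hom.appₗ_apply, ← app_map_apply, hφ ⟨V, hV⟩, hg₁]

end TwoOpens

end AlgebraicGeometry.Scheme.Modules

/-! ### Exactness on sections and uniqueness of glued morphisms -/

namespace AlgebraicGeometry.Scheme.Modules

variable {X : Scheme.{u}}

theorem exact_app {S : ShortComplex X.Modules} (hS : S.ShortExact) (U : X.Opens) :
    Function.Exact (S.f.app U) (S.g.app U) := by
  let F : X.Modules ⥤ Ab.{u} := toPresheaf X ⋙ (CategoryTheory.evaluation _ Ab).obj (op U)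
  have hF : F.PreservesZeroMorphisms := ⟨fun _ _ ↦ rfl⟩
  have h1 : Limits.PreservesFiniteLimits (toPresheaf X) := inferInstance
  have h2 : Limits.PreservesFiniteLimits
    ((CategoryTheory.evaluation X.Opensᵒᵖ Ab.{u}).obj (op U)) := inferInstance
  have h3 : Limits.PreservesFiniteLimits F :=
    @Limits.comp_preservesFiniteLimits _ _ _ _ _ _ (toPresheaf X) _ h1 h2
  have h := hS.exact.map_of_mono_of_preservesKernel F hS.mono_f inferInstance
  rw [ShortComplex.ab_exact_iff] at h
  refine fun x ↦ ⟨fun hx ↦ h x hx, ?_⟩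
  rintro ⟨y, rfl⟩
  have := congr(($(S.zero).app U) y)
  exact this

theorem RestrictsOnto.linearMap_ext {M N : X.Modules} {U V : X.Opens} {i : V ⟶ U}
    (hi : M.RestrictsOnto i) {a b : Γ(M, V) →ₗ[Γ(X, V)] Γ(N, V)}
    (h : ∀ y : Γ(M, U), a (M.presheaf.map i.op y) = b (M.presheaf.map i.op y)) : a = b := by
  ext x
  obtain ⟨r, y, hr, hy⟩ := hi x
  have := h y
  rw [hy, _root_.map_smul, _root_.map_smul] at this
  exact hr.smul_left_cancel.1 this

theorem hom_ext_of_two_opens {M N : X.Modules} {U₀ U₁ : X.Opens} (hU₀ : IsAffineOpen U₀)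
    (hU₁ : IsAffineOpen U₁) (hU : U₀ ⊔ U₁ = ⊤) (hM₀ : M.IsLocalizingOn U₀)
    (hM₁ : M.IsLocalizingOn U₁) {φ ψ : M ⟶ N} (h₀ : φ.appₗ U₀ = ψ.appₗ U₀)
    (h₁ : φ.appₗ U₁ = ψ.appₗ U₁) : φ = ψ := by
  refine Scheme.Modules.hom_ext _ _ fun U ↦ ?_
  ext x
  refine N.section_ext_of_isBasis (isBasis_basicOpen hU₀ hU₁ hU) fun V hV i ↦ ?_
  rw [← app_map_apply, ← app_map_apply]
  obtain ⟨r, rfl⟩ | ⟨r, rfl⟩ := hV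
  · refine LinearMap.congr_fun ((hM₀.restrictsOnto rfl (homOfLE
      (X.basicOpen_le r))).linearMap_ext (a := φ.appₗ _) (b := ψ.appₗ _) fun y ↦ ?_) _
    rw [Hom.appₗ_apply, Hom.appₗ_apply, app_map_apply, app_map_apply]
    exact congr(N.presheaf.map _ ($h₀ y))
  · refine LinearMap.congr_fun ((hM₁.restrictsOnto rfl (homOfLE
      (X.basicOpen_le r))).linearMap_ext (a := φ.appₗ _) (b := ψ.appₗ _) fun y ↦ ?_) _
    rw [Hom.appₗ_apply, Hom.appₗ_apply, app_map_apply, app_map_apply]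
    exact congr(N.presheaf.map _ ($h₁ y))

/-- Sections of `Y` over the basic open are a module over the functions on `U`, and tensoring over
the localized ring is tensoring over the original one. This is why `H` ranges over all modules. -/
theorem lTensor_appₗ_basicOpen_injective {A B : X.Modules} (φ : A ⟶ B) (Y : X.Modules)
    {U : X.Opens} (hU : IsAffineOpen U) (hA : A.IsLocalizingOn U) (hB : B.IsLocalizingOn U)
    (H : ∀ (Z : Type u) [AddCommGroup Z] [Module Γ(X, U) Z],
      Function.Injective ((φ.appₗ U).lTensor Z)) (f : Γ(X, U)) :
    Function.Injective ((φ.appₗ (X.basicOpen f)).lTensor Γ(Y, X.basicOpen f)) := by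
  have hle := X.basicOpen_le f
  let _ := algebraOfLE hle
  let _ := Y.moduleOfLE hle
  let _ := A.moduleOfLE hle
  let _ := B.moduleOfLE hle
  have := Y.isScalarTower_of_le hle
  have := A.isScalarTower_of_le hle
  have := B.isScalarTower_of_le hle
  have h3 : IsLocalization.Away f Γ(X, X.basicOpen f) := hU.isLocalization_basicOpen f
  have h1 := (isLocalizedModule_iff_isBaseChange (.powers f) Γ(X, X.basicOpen f) _).1
    (hA.isLocalizedModule hle rfl)
  have h2 := (isLocalizedModule_iff_isBaseChange (.powers f) Γ(X, X.basicOpen f) _).1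
    (hB.isLocalizedModule hle rfl)
  exact h1.lTensor_injective h2 (f := φ.appₗ U) (fun a ↦ app_map_apply φ _ a) (H _)

end AlgebraicGeometry.Scheme.Modules

/-! ### Purity and lifting on a scheme with two charts -/

namespace GPure

open Scheme.Modules

/-- A cover of a scheme by two affine opens, whose rings of functions are quotients of a polynomial
ring in one variable, and whose intersection is a basic open subset of both. -/
structure TwoCharts (k : Type u) [Field k] (X : Scheme.{u}) where
  U : X.Opens
  V : X.Opens
  isAffineOpen_U : IsAffineOpen U
  isAffineOpen_V : IsAffineOpen V
  sup_eq_top : U ⊔ V = ⊤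
  nonempty_U : Nonempty U
  nonempty_V : Nonempty V
  const : k →+* Γ(X, ⊤)
  t : Γ(X, U)
  s : Γ(X, V)
  inf_eq_t : U ⊓ V = X.basicOpen t
  inf_eq_s : U ⊓ V = X.basicOpen s
  surjective_U : Function.Surjective
    (Polynomial.eval₂RingHom ((X.presheaf.map U.leTop.op).hom.comp const) t)
  surjective_V : Function.Surjective
    (Polynomial.eval₂RingHom ((X.presheaf.map V.leTop.op).hom.comp const) s)

namespace TwoCharts

variable {k : Type u} [Field k] {X : Scheme.{u}} (c : TwoCharts k X)

/-- The cover with the two charts exchanged. -/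
def swap : TwoCharts k X where
  U := c.V
  V := c.U
  isAffineOpen_U := c.isAffineOpen_V
  isAffineOpen_V := c.isAffineOpen_U
  sup_eq_top := by rw [sup_comm, c.sup_eq_top]
  nonempty_U := c.nonempty_V
  nonempty_V := c.nonempty_U
  const := c.const
  t := c.s
  s := c.t
  inf_eq_t := by rw [inf_comm, c.inf_eq_s]
  inf_eq_s := by rw [inf_comm, c.inf_eq_t]
  surjective_U := c.surjective_V
  surjective_V := c.surjective_U

theorem isDomain [IsIntegral X] : IsDomain Γ(X, c.U) :=
  have := c.nonempty_U
  inferInstance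

theorem isPrincipalIdealRing : IsPrincipalIdealRing Γ(X, c.U) :=
  IsPrincipalIdealRing.of_surjective _ c.surjective_U

theorem restrictsOnto {M : X.Modules} [M.IsQuasicoherent] {W : X.Opens} (hW : W = c.U ⊓ c.V)
    (i : W ⟶ c.U) : M.RestrictsOnto i :=
  (isLocalizingOn_of_isQuasicoherent c.isAffineOpen_U).restrictsOnto (hW.trans c.inf_eq_t) i

variable [IsIntegral X] {S : ShortComplex X.Modules} (hS : S.ShortExact)
  [S.X₁.IsQuasicoherent] [S.X₂.IsQuasicoherent] [S.X₃.IsQuasicoherent]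

include hS in
theorem lTensor_injective (h : ∀ d, (S.g.appₗ c.U).LiftsTorsionBy d)
    (Y : X.Modules) (f : Γ(X, c.U)) :
    Function.Injective ((S.f.appₗ (X.basicOpen f)).lTensor Γ(Y, X.basicOpen f)) := by
  have := c.isDomain
  have := c.isPrincipalIdealRing
  have := hS.mono_f
  have := hS.epi_g
  exact lTensor_appₗ_basicOpen_injective S.f Y c.isAffineOpen_U
    (isLocalizingOn_of_isQuasicoherent c.isAffineOpen_U)
    (isLocalizingOn_of_isQuasicoherent c.isAffineOpen_U) (fun Z _ _ ↦
    LinearMap.lTensor_injective_of_liftsTorsionBy (f := S.f.appₗ c.U)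
      (g := S.g.appₗ c.U) (app_injective_of_mono S.f c.U)
      (exact_app hS c.U) (app_surjective_of_epi S.g c.isAffineOpen_U) h Z) f

include hS in
theorem isGPureExact (hU : ∀ d, (S.g.appₗ c.U).LiftsTorsionBy d)
    (hV : ∀ d, (S.g.appₗ c.V).LiftsTorsionBy d) : IsGPureExact S := by
  intro Y
  have := hS.epi_g
  refine shortExact_map_sheafTensor S Y
    (isBasis_basicOpen c.isAffineOpen_U c.isAffineOpen_V c.sup_eq_top) ?_ ?_ ?_
  · rintro W (⟨r, rfl⟩ | ⟨r, rfl⟩)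
    · exact c.lTensor_injective hS hU Y r
    · exact c.swap.lTensor_injective hS hV Y r
  · exact fun W _ ↦ exact_app hS W
  · rintro W (⟨r, rfl⟩ | ⟨r, rfl⟩)
    · exact app_surjective_of_epi S.g (c.isAffineOpen_U.basicOpen r)
    · exact app_surjective_of_epi S.g (c.isAffineOpen_V.basicOpen r)

omit [IsIntegral X] in
theorem exists_linearMap {M N : X.Modules} [M.IsQuasicoherent] [N.IsQuasicoherent]
    (g : Γ(M, c.U) →ₗ[Γ(X, c.U)] Γ(N, c.U)) {W : X.Opens} (hW : W = c.U ⊓ c.V) (i : W ⟶ c.U) :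
    ∃ g' : Γ(M, W) →ₗ[Γ(X, W)] Γ(N, W),
      ∀ x, g' (M.presheaf.map i.op x) = N.presheaf.map i.op (g x) :=
  (isLocalizingOn_of_isQuasicoherent c.isAffineOpen_U).exists_linearMap
    (isLocalizingOn_of_isQuasicoherent c.isAffineOpen_U) c.isAffineOpen_U (hW.trans c.inf_eq_t) g i

/-- Every homomorphism on the intersection of the charts from a torsion coherent sheaf extends to
a chart. -/
theorem exists_extension {T N : X.Modules} [N.IsQuasicoherent] (hT : IsCoherent T)
    (hT' : IsTorsion T) {W : X.Opens} (hW : W = c.U ⊓ c.V) (i : W ⟶ c.U)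
    (δ : Γ(T, W) →ₗ[Γ(X, W)] Γ(N, W)) :
    ∃ d : Γ(T, c.U) →ₗ[Γ(X, c.U)] Γ(N, c.U),
      ∀ x, N.presheaf.map i.op (d x) = δ (T.presheaf.map i.op x) := by
  have := c.isDomain
  have := c.isPrincipalIdealRing
  have := hT.1
  have := hT.2 c.U c.isAffineOpen_U
  let _ := algebraOfLE i.le
  let _ := T.moduleOfLE i.le
  let _ := N.moduleOfLE i.le
  have := T.isScalarTower_of_le i.le
  have := N.isScalarTower_of_le i.le
  have h1 := (isLocalizingOn_of_isQuasicoherent (M := T) c.isAffineOpen_U).isLocalizedModule i.le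
    (hW.trans c.inf_eq_t)
  have h2 := (isLocalizingOn_of_isQuasicoherent (M := N) c.isAffineOpen_U).isLocalizedModule i.le
    (hW.trans c.inf_eq_t)
  obtain ⟨d, hd⟩ := IsLocalizedModule.Away.exists_lift_of_isTorsion c.t
    (hT' c.U c.isAffineOpen_U) (T.resₗ i.le) (N.resₗ i.le) (δ.restrictScalars Γ(X, c.U))
  exact ⟨d, fun x ↦ LinearMap.congr_fun hd x⟩

-- Local lifts exist by the structure theorem. Over the overlap they differ by `δ` with values in
-- the subsheaf `S.X₁`. As `T` is torsion, `δ` extends to a map `d` on the first chart, and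
-- subtracting it there makes the lifts agree.
include hS in
theorem exists_lift (hU : ∀ d, (S.g.appₗ c.U).LiftsTorsionBy d)
    (hV : ∀ d, (S.g.appₗ c.V).LiftsTorsionBy d) {T : X.Modules} (hT : IsCoherent T)
    (hT' : IsTorsion T) (φ : T ⟶ S.X₃) : ∃ ψ : T ⟶ S.X₂, ψ ≫ S.g = φ := by
  have hd0 := c.isDomain
  have hp0 := c.isPrincipalIdealRing
  have hd1 : IsDomain Γ(X, c.V) := c.swap.isDomain
  have hp1 : IsPrincipalIdealRing Γ(X, c.V) := c.swap.isPrincipalIdealRing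
  have hq := hT.1
  have hf0 := hT.2 c.U c.isAffineOpen_U
  have hf1 := hT.2 c.V c.isAffineOpen_V
  have hm := hS.mono_f
  have he := hS.epi_g
  obtain ⟨ψ₀, hψ₀⟩ := LinearMap.exists_lift_of_finite_of_liftsTorsionBy (g := S.g.appₗ c.U)
    (app_surjective_of_epi S.g c.isAffineOpen_U) (fun p _ n ↦ hU (p ^ n)) (φ.appₗ c.U)
  obtain ⟨ψ₁, hψ₁⟩ := LinearMap.exists_lift_of_finite_of_liftsTorsionBy (g := S.g.appₗ c.V)
    (app_surjective_of_epi S.g c.isAffineOpen_V) (fun p _ n ↦ hV (p ^ n)) (φ.appₗ c.V)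
  let i₀ : c.U ⊓ c.V ⟶ c.U := homOfLE inf_le_left
  let i₁ : c.U ⊓ c.V ⟶ c.V := homOfLE inf_le_right
  have hr₀ : T.RestrictsOnto i₀ := c.restrictsOnto rfl i₀
  have hr₁ : T.RestrictsOnto i₁ := c.swap.restrictsOnto (inf_comm _ _) i₁
  obtain ⟨h₀, hh₀⟩ := c.exists_linearMap ψ₀ rfl i₀
  obtain ⟨h₁, hh₁⟩ : ∃ h₁ : Γ(T, c.U ⊓ c.V) →ₗ[Γ(X, c.U ⊓ c.V)] Γ(S.X₂, c.U ⊓ c.V),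
      ∀ x, h₁ (T.presheaf.map i₁.op x) = S.X₂.presheaf.map i₁.op (ψ₁ x) :=
    c.swap.exists_linearMap ψ₁ (inf_comm _ _) i₁
  have hg₀ : S.g.appₗ _ ∘ₗ h₀ = φ.appₗ _ := hr₀.linearMap_ext fun y ↦ by
    rw [LinearMap.comp_apply, hh₀, Hom.appₗ_apply, Hom.appₗ_apply, app_map_apply, app_map_apply]
    exact congr(S.X₃.presheaf.map i₀.op ($hψ₀ y))
  have hg₁ : S.g.appₗ _ ∘ₗ h₁ = φ.appₗ _ := hr₁.linearMap_ext fun y ↦ by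
    rw [LinearMap.comp_apply, hh₁, Hom.appₗ_apply, Hom.appₗ_apply, app_map_apply, app_map_apply]
    exact congr(S.X₃.presheaf.map i₁.op ($hψ₁ y))
  have hinj : Function.Injective (S.f.appₗ (c.U ⊓ c.V)) := app_injective_of_mono S.f _
  have hδ (x) : (h₀ - h₁) x ∈ LinearMap.range (S.f.appₗ (c.U ⊓ c.V)) := by
    refine (exact_app hS _ _).1 ?_
    have := LinearMap.congr_fun (hg₀.trans hg₁.symm) x
    rw [LinearMap.sub_apply, map_sub, sub_eq_zero]
    exact this
  let δ : Γ(T, c.U ⊓ c.V) →ₗ[Γ(X, c.U ⊓ c.V)] Γ(S.X₁, c.U ⊓ c.V) :=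
    (LinearEquiv.ofInjective _ hinj).symm.toLinearMap ∘ₗ LinearMap.codRestrict _ (h₀ - h₁) hδ
  have hfδ (x) : S.f.app _ (δ x) = h₀ x - h₁ x := by
    have := LinearEquiv.ofInjective_apply (h := hinj) _ ((LinearEquiv.ofInjective _ hinj).symm
      (LinearMap.codRestrict _ (h₀ - h₁) hδ x))
    rw [LinearEquiv.apply_symm_apply] at this
    exact this.symm
  obtain ⟨d, hd⟩ := c.exists_extension hT hT' rfl i₀ δ
  obtain ⟨ψ, hψU, hψV⟩ := exists_hom_of_two_opens i₀ i₁ le_rfl (M := T) (N := S.X₂)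
    (f₀ := ψ₀ - S.f.appₗ c.U ∘ₗ d) (f₁ := ψ₁) h₁
    (fun x ↦ by
      rw [LinearMap.sub_apply, map_sub, ← hh₀, LinearMap.comp_apply, Hom.appₗ_apply,
        ← app_map_apply, hd, hfδ, sub_sub_cancel]) hh₁ c.isAffineOpen_U c.isAffineOpen_V
    c.sup_eq_top (isLocalizingOn_of_isQuasicoherent c.isAffineOpen_U)
    (isLocalizingOn_of_isQuasicoherent c.isAffineOpen_U)
    (isLocalizingOn_of_isQuasicoherent c.isAffineOpen_V)
    (isLocalizingOn_of_isQuasicoherent c.isAffineOpen_V) hr₀ hr₁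
  refine ⟨ψ, hom_ext_of_two_opens c.isAffineOpen_U c.isAffineOpen_V c.sup_eq_top
    (isLocalizingOn_of_isQuasicoherent c.isAffineOpen_U)
    (isLocalizingOn_of_isQuasicoherent c.isAffineOpen_V) ?_ ?_⟩
  · rw [← hψ₀]
    ext x
    have h1 : (ψ ≫ S.g).appₗ c.U x = S.g.appₗ c.U (ψ.appₗ c.U x) := rfl
    rw [h1, hψU, LinearMap.comp_apply, LinearMap.sub_apply, map_sub, sub_eq_self]
    exact (exact_app hS _ _).2 ⟨_, rfl⟩
  · rw [← hψ₁, ← hψV]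
    rfl

/-- A section killed by `d` is a map on the first chart from `T`. Its restriction to the overlap
extends to the second chart because `T` is torsion, giving a global map to which `H` applies. -/
theorem liftsTorsionBy_of_exists_lift {B C : X.Modules} [C.IsQuasicoherent] (g : B ⟶ C)
    {T : X.Modules} (hT : IsCoherent T) (hT' : IsTorsion T) {d : Γ(X, c.U)}
    (e : Γ(T, c.U) ≃ₗ[Γ(X, c.U)] Γ(X, c.U) ⧸ Ideal.span {d})
    (H : ∀ φ : T ⟶ C, ∃ ψ : T ⟶ B, ψ ≫ g = φ) : (g.appₗ c.U).LiftsTorsionBy d := by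
  intro x hx
  have hq := hT.1
  let i₀ : c.U ⊓ c.V ⟶ c.U := homOfLE inf_le_left
  let i₁ : c.U ⊓ c.V ⟶ c.V := homOfLE inf_le_right
  have hr₀ : T.RestrictsOnto i₀ := c.restrictsOnto rfl i₀
  have hr₁ : T.RestrictsOnto i₁ := c.swap.restrictsOnto (inf_comm _ _) i₁
  let φ₀ : Γ(T, c.U) →ₗ[Γ(X, c.U)] Γ(C, c.U) :=
    (Submodule.liftQSpanSingleton _ (LinearMap.toSpanSingleton _ _ x) (by simpa)) ∘ₗ e.toLinearMap
  have hφ₀ : φ₀ (e.symm 1) = x := by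
    simp only [φ₀, LinearMap.comp_apply, LinearEquiv.coe_coe, LinearEquiv.apply_symm_apply]
    exact one_smul _ x
  obtain ⟨h₀, hh₀⟩ := c.exists_linearMap φ₀ rfl i₀
  obtain ⟨φ₁, hφ₁⟩ := c.swap.exists_extension (N := C) hT hT' (inf_comm _ _) i₁ h₀
  obtain ⟨φ, hφU, -⟩ := exists_hom_of_two_opens i₀ i₁ le_rfl h₀ hh₀ (fun x ↦ (hφ₁ x).symm)
    c.isAffineOpen_U c.isAffineOpen_V
    c.sup_eq_top (isLocalizingOn_of_isQuasicoherent c.isAffineOpen_U)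
    (isLocalizingOn_of_isQuasicoherent c.isAffineOpen_U)
    (isLocalizingOn_of_isQuasicoherent c.isAffineOpen_V)
    (isLocalizingOn_of_isQuasicoherent c.isAffineOpen_V) hr₀ hr₁
  obtain ⟨ψ, rfl⟩ := H φ
  refine ⟨ψ.appₗ c.U (e.symm 1), ?_, ?_⟩
  · rw [← _root_.map_smul, ← _root_.map_smul]
    have : d • (1 : Γ(X, c.U) ⧸ Ideal.span {d}) = 0 := by
      rw [Algebra.smul_def, mul_one]
      exact Ideal.Quotient.eq_zero_iff_mem.2 (Ideal.mem_span_singleton_self d)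
    rw [this, map_zero, map_zero]
  · rw [← hφ₀, ← hφU]
    rfl

end TwoCharts

end GPure

/-! ### Torsion sheaves supported at one point -/

/-- A proper quotient of `k[X]` is finite over `k`. -/
theorem Polynomial.finite_comp_C_of_surjective {k B : Type*} [Field k] [CommRing B]
    (e : Polynomial k →+* B) (he : Function.Surjective e) {q : Polynomial k} (hq : q ≠ 0)
    (heq : e q = 0) : (e.comp Polynomial.C).Finite := by
  let q' := Polynomial.C q.leadingCoeff⁻¹ * q
  have hq' : q'.Monic := by
    rw [show q' = q * Polynomial.C q.leadingCoeff⁻¹ from mul_comm _ _]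
    exact Polynomial.monic_mul_leadingCoeff_inv hq
  have hfin : Module.Finite k (AdjoinRoot q') := hq'.finite_adjoinRoot
  have heq' : ∀ a ∈ Ideal.span {q'}, e a = 0 := by
    intro a ha
    obtain ⟨b, rfl⟩ := Ideal.mem_span_singleton.1 ha
    simp [q', heq]
  let e' : AdjoinRoot q' →+* B := Ideal.Quotient.lift _ e heq'
  have h1 : e'.Finite := RingHom.Finite.of_surjective _ (Ideal.Quotient.lift_surjective_of_surjective _ _ he)
  have h2 : (algebraMap k (AdjoinRoot q')).Finite := RingHom.finite_algebraMap.2 hfin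
  exact h1.comp h2

namespace AlgebraicGeometry.Scheme.Modules

variable {X Z : Scheme.{u}} (g : Z ⟶ X)

theorem IsLocalizingOn.pushforward {N : Z.Modules} {U : X.Opens}
    (hN : N.IsLocalizingOn (g ⁻¹ᵁ U)) : ((pushforward g).obj N).IsLocalizingOn U where
  surj f s := by
    -- The preimage of a basic open is a basic open only up to an equality of opens, so the claim is
    -- made for any `V` and the equality substituted.
    have key (V : Z.Opens) (hV : V = Z.basicOpen (g.app U f)) (i : V ⟶ g ⁻¹ᵁ U) (s : Γ(N, V)) :
        ∃ (n : ℕ) (t : Γ(N, g ⁻¹ᵁ U)), N.presheaf.map i.op t =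
          Z.presheaf.map i.op (g.app U f) ^ n • s := by
      subst hV
      exact hN.surj _ s
    obtain ⟨n, t, ht⟩ := key (g ⁻¹ᵁ X.basicOpen f) (Scheme.preimage_basicOpen ..)
      ((TopologicalSpace.Opens.map g.base).map (homOfLE (X.basicOpen_le f))) s
    refine ⟨n, t, ht.trans ?_⟩
    have h : g.app (X.basicOpen f) (X.presheaf.map (homOfLE (X.basicOpen_le f)).op f) =
        Z.presheaf.map ((TopologicalSpace.Opens.map g.base).map (homOfLE (X.basicOpen_le f))).op
          (g.app U f) := congr($(g.naturality (homOfLE (X.basicOpen_le f)).op) f)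
    rw [← h, ← map_pow]
    rfl
  inj f t ht := by
    have key (V : Z.Opens) (hV : V = Z.basicOpen (g.app U f)) (i : V ⟶ g ⁻¹ᵁ U)
        (ht : N.presheaf.map i.op t = 0) : ∃ n : ℕ, @HSMul.hSMul Γ(Z, g ⁻¹ᵁ U) Γ(N, g ⁻¹ᵁ U) _ _ (g.app U f ^ n) t = 0 := by
      subst hV
      exact hN.inj _ t ht
    obtain ⟨n, hn⟩ := key (g ⁻¹ᵁ X.basicOpen f) (Scheme.preimage_basicOpen ..)
      ((TopologicalSpace.Opens.map g.base).map (homOfLE (X.basicOpen_le f))) ht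
    refine ⟨n, ?_⟩
    rw [← map_pow] at hn
    exact hn

/-- The direct image of the structure sheaf. -/
def pushforwardUnit : X.Modules :=
  (pushforward g).obj (SheafOfModules.unit Z.ringCatSheaf)

theorem isLocalizingOn_unit {V : Z.Opens} (hV : IsAffineOpen V) :
    IsLocalizingOn (SheafOfModules.unit Z.ringCatSheaf) V where
  surj f s := by
    have := hV.isLocalization_basicOpen f
    obtain ⟨n, t, ht⟩ := IsLocalization.Away.surj (S := Γ(Z, Z.basicOpen f)) f s
    refine ⟨n, t, ht.symm.trans ?_⟩
    exact mul_comm _ _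
  inj f t ht := by
    have := hV.isLocalization_basicOpen f
    obtain ⟨⟨_, n, rfl⟩, hn⟩ := (IsLocalization.map_eq_zero_iff (.powers f) Γ(Z, Z.basicOpen f)
      (t : Γ(Z, V))).1 ht
    exact ⟨n, hn⟩

/-- The map from functions on an open to sections of the direct image of the structure sheaf. -/
def toPushforwardUnit (W : X.Opens) : Γ(X, W) →ₗ[Γ(X, W)] Γ(pushforwardUnit g, W) where
  toFun r := (g.app W r : Γ(Z, g ⁻¹ᵁ W))
  map_add' := map_add (g.app W).hom
  map_smul' := map_mul (g.app W).hom

theorem opens_eq_bot_or_eq_top [Subsingleton Z] (W : Z.Opens) : W = ⊥ ∨ W = ⊤ := by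
  rcases W.1.eq_empty_or_nonempty with h | ⟨x, hx⟩
  · exact .inl (TopologicalSpace.Opens.ext h)
  · exact .inr (top_le_iff.1 fun y _ ↦ by rwa [Subsingleton.elim y x])

/-- On a one-point affine scheme every open is empty or everything, so the preimage of any chart is
affine. -/
theorem isQuasicoherent_pushforwardUnit [Subsingleton Z] [IsAffine Z] {U₀ U₁ : X.Opens}
    (hU₀ : IsAffineOpen U₀) (hU₁ : IsAffineOpen U₁) (hU : U₀ ⊔ U₁ = ⊤) :
    (pushforwardUnit g).IsQuasicoherent := by
  refine isQuasicoherent_of_isLocalizingOn (ι := ULift Bool) _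
    (fun i ↦ Bool.rec U₀ U₁ i.down) ?_ ?_ fun i ↦ ?_
  · rw [← Equiv.ulift.symm.iSup_comp, iSup_bool_eq, sup_comm]
    exact hU
  · rintro ⟨_ | _⟩
    exacts [hU₀, hU₁]
  · refine IsLocalizingOn.pushforward g (isLocalizingOn_unit ?_)
    obtain h | h := opens_eq_bot_or_eq_top (g ⁻¹ᵁ (Bool.rec U₀ U₁ i.down : X.Opens))
    · rw [h]
      exact isAffineOpen_bot Z
    · rw [h]
      exact isAffineOpen_top Z

theorem map_surjective_of_subsingleton [Subsingleton Z] {V W : Z.Opens} (i : V ⟶ W) :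
    Function.Surjective (Z.presheaf.map i.op) := by
  obtain rfl | rfl := opens_eq_bot_or_eq_top V
  · intro x
    exact ⟨0, Subsingleton.elim _ _⟩
  · obtain rfl : W = ⊤ := top_le_iff.1 i.le
    intro x
    exact ⟨x, congr($(Z.presheaf.map_id _) x)⟩

theorem map_injective_of_subsingleton [Subsingleton Z] {V W : Z.Opens} (i : V ⟶ W)
    (hV : V = ⊤) : Function.Injective (Z.presheaf.map i.op) := by
  subst hV
  obtain rfl : W = ⊤ := top_le_iff.1 i.le
  intro x y h
  exact ((congr($(Z.presheaf.map_id _) x)).symm.trans h).trans congr($(Z.presheaf.map_id _) y)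

theorem subsingleton_of_preimage_eq_bot {W : X.Opens} (h : g ⁻¹ᵁ W = ⊥) :
    Subsingleton Γ(pushforwardUnit g, W) := by
  have : Subsingleton Γ(Z, g ⁻¹ᵁ W) := by
    rw [h]
    infer_instance
  exact this

theorem naturality_apply {V W : X.Opens} (i : V ⟶ W) (x : Γ(X, W)) :
    g.app V (X.presheaf.map i.op x) =
      Z.presheaf.map ((TopologicalSpace.Opens.map g.base).map i).op (g.app W x) :=
  congr($(g.naturality i.op) x)

theorem app_finite_of_subsingleton [Subsingleton Z] {k : Type u} [Field k] (const : k →+* Γ(X, ⊤))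
    (h : ((g.app ⊤).hom.comp const).Finite) (W : X.Opens) : (g.app W).hom.Finite := by
  have h1 : ((Z.presheaf.map ((TopologicalSpace.Opens.map g.base).map W.leTop).op).hom).Finite :=
    RingHom.Finite.of_surjective _ (map_surjective_of_subsingleton _)
  have h2 := h1.comp h
  refine RingHom.Finite.of_comp_finite (f := (X.presheaf.map W.leTop.op).hom.comp const) ?_
  convert h2 using 1
  ext x
  exact naturality_apply g W.leTop (const x)

/-- When the preimage of `W` is nonempty, passing from `W` to `W ⊓ U` loses no sections, and all
sections there come from `U`. -/
theorem hom_ext_pushforwardUnit [Subsingleton Z] {U : X.Opens} (hU : g ⁻¹ᵁ U = ⊤)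
    {a b : pushforwardUnit g ⟶ pushforwardUnit g} (h : a.appₗ U = b.appₗ U) : a = b := by
  refine Scheme.Modules.hom_ext _ _ fun W ↦ ?_
  ext x
  obtain hW | hW := opens_eq_bot_or_eq_top (g ⁻¹ᵁ W)
  · have := subsingleton_of_preimage_eq_bot g hW
    exact Subsingleton.elim _ _
  · let i : W ⊓ U ⟶ W := homOfLE inf_le_left
    let j : W ⊓ U ⟶ U := homOfLE inf_le_right
    have hi : Function.Injective ((pushforwardUnit g).presheaf.map i.op) :=
      map_injective_of_subsingleton ((TopologicalSpace.Opens.map g.base).map i) (by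
        change g ⁻¹ᵁ W ⊓ g ⁻¹ᵁ U = ⊤
        rw [hW, hU, inf_idem])
    have hj : Function.Surjective ((pushforwardUnit g).presheaf.map j.op) :=
      map_surjective_of_subsingleton ((TopologicalSpace.Opens.map g.base).map j)
    apply hi
    obtain ⟨y, hy⟩ := hj ((pushforwardUnit g).presheaf.map i.op x)
    rw [← app_map_apply, ← app_map_apply, ← hy, app_map_apply, app_map_apply]
    exact congr((pushforwardUnit g).presheaf.map j.op ($h y))

/-- Choose a basic open of `W` around the image point and inside `U`. Clearing the denominator of
`p` there gives `h` on `W`, nonzero by integrality and nilpotent on `Z`, so a power of `h` kills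
every section over `W`. -/
theorem isTorsion_pushforwardUnit [Subsingleton Z] [IsIntegral X] {U : X.Opens}
    (hU : g ⁻¹ᵁ U = ⊤) {p : Γ(X, U)} (hp : p ≠ 0) (hgp : IsNilpotent (g.app U p)) :
    GPure.IsTorsion (pushforwardUnit g) := by
  intro W hW x
  obtain hgW | hgW := opens_eq_bot_or_eq_top (g ⁻¹ᵁ W)
  · have := subsingleton_of_preimage_eq_bot g hgW
    exact ⟨1, Subsingleton.elim _ _⟩
  · have hWtop : Subsingleton Γ(Z, g ⁻¹ᵁ W) ∨ Nonempty Z := by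
      obtain h | h := isEmpty_or_nonempty Z
      · left
        have : g ⁻¹ᵁ W = ⊥ := TopologicalSpace.Opens.ext (Subsingleton.elim _ _)
        rw [this]
        infer_instance
      · exact .inr h
    obtain h | ⟨⟨z⟩⟩ := hWtop
    · exact ⟨1, h.elim _ _⟩
    have hzW : g z ∈ W := by
      have : z ∈ g ⁻¹ᵁ W := hgW ▸ TopologicalSpace.Opens.mem_top z
      exact this
    have hzU : g z ∈ U := by
      have : z ∈ g ⁻¹ᵁ U := hU ▸ TopologicalSpace.Opens.mem_top z
      exact this
    obtain ⟨f, hfU, hzf⟩ := hW.exists_basicOpen_le ⟨g z, hzU⟩ hzW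
    have hloc := hW.isLocalization_basicOpen f
    let i : X.basicOpen f ⟶ W := homOfLE (X.basicOpen_le f)
    let j : X.basicOpen f ⟶ U := homOfLE hfU
    have hne : Nonempty (X.basicOpen f) := ⟨⟨g z, hzf⟩⟩
    have hneW : Nonempty W := ⟨⟨g z, hzW⟩⟩
    obtain ⟨n, h, hh⟩ := IsLocalization.Away.surj (S := Γ(X, X.basicOpen f)) f
      (X.presheaf.map j.op p)
    have hh' : X.presheaf.map j.op p * X.presheaf.map i.op f ^ n = X.presheaf.map i.op h := hh
    have hf : X.presheaf.map i.op f ≠ 0 := by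
      have h1 : IsUnit (X.presheaf.map i.op f) := isUnit_map_of_le_basicOpen i le_rfl
      exact h1.ne_zero
    have hh0 : h ≠ 0 := by
      rintro rfl
      rw [map_zero] at hh'
      refine hp (map_injective_of_isIntegral X j ?_)
      rw [map_zero]
      exact (mul_eq_zero.1 hh').resolve_right (pow_ne_zero _ hf)
    have hnil : IsNilpotent (g.app W h) := by
      have hV : g ⁻¹ᵁ X.basicOpen f = ⊤ := top_le_iff.1 fun y _ ↦ by
        rw [Subsingleton.elim y z]
        exact hzf
      have hinj := map_injective_of_subsingleton ((TopologicalSpace.Opens.map g.base).map i) hV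
      rw [← IsNilpotent.map_iff (f := (Z.presheaf.map
        ((TopologicalSpace.Opens.map g.base).map i).op).hom) hinj]
      have h1 := naturality_apply g i h
      rw [← hh', map_mul, naturality_apply g j p] at h1
      change IsNilpotent (Z.presheaf.map ((TopologicalSpace.Opens.map g.base).map i).op (g.app W h))
      rw [← h1]
      exact Commute.isNilpotent_mul_right (Commute.all _ _) (hgp.map _)
    obtain ⟨m, hm⟩ := hnil
    refine ⟨⟨h ^ m, mem_nonZeroDivisors_of_ne_zero (pow_ne_zero _ hh0)⟩, ?_⟩
    have h2 : @HMul.hMul Γ(Z, g ⁻¹ᵁ W) Γ(Z, g ⁻¹ᵁ W) _ _ (g.app W (h ^ m)) x = 0 := by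
      rw [map_pow, hm]
      exact zero_mul _
    exact h2

/-- An object whose idempotent endomorphisms are trivial is indecomposable. -/
theorem indecomposable_of_idempotent {C : Type*} [Category C] [Preadditive C]
    [Limits.HasBinaryBiproducts C] {T : C} (hT : ¬ Limits.IsZero T)
    (h : ∀ e : T ⟶ T, e ≫ e = e → e = 0 ∨ e = 𝟙 T) : Indecomposable T := by
  refine ⟨hT, fun Y Z i ↦ ?_⟩
  let e : T ⟶ T := i.hom ≫ Limits.biprod.fst ≫ Limits.biprod.inl ≫ i.inv
  have he : Limits.biprod.inl ≫ i.inv ≫ e ≫ i.hom ≫ Limits.biprod.fst = 𝟙 Y := by simp [e]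
  have he' : Limits.biprod.inr ≫ i.inv ≫ e ≫ i.hom ≫ Limits.biprod.snd = 0 := by simp [e]
  obtain h0 | h1 := h e (by simp [e])
  · left
    rw [Limits.IsZero.iff_id_eq_zero, ← he, h0]
    simp
  · right
    rw [Limits.IsZero.iff_id_eq_zero, ← he', h1]
    simp

/-- An endomorphism is multiplication by some `r`. If it is idempotent, `p ^ n` divides `r * (r -
1)`; the prime `p` cannot divide both factors, so `p ^ n` divides one of them. -/
theorem indecomposable_pushforwardUnit [Subsingleton Z] {U : X.Opens} (hU : g ⁻¹ᵁ U = ⊤)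
    [IsDomain Γ(X, U)] [IsPrincipalIdealRing Γ(X, U)] (hg : Function.Surjective (g.app U))
    {p : Γ(X, U)} (hp : Prime p) {n : ℕ} (hn : n ≠ 0)
    (hker : RingHom.ker (g.app U).hom = Ideal.span {p ^ n}) :
    Indecomposable (pushforwardUnit g) := by
  have hmem (r : Γ(X, U)) : g.app U r = 0 ↔ p ^ n ∣ r := by
    rw [← Ideal.mem_span_singleton, ← hker, RingHom.mem_ker]
  let π := toPushforwardUnit g U
  have hπ : Function.Surjective π := hg
  have hπ0 (r : Γ(X, U)) : π r = 0 ↔ p ^ n ∣ r := hmem r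
  apply indecomposable_of_idempotent
  · intro h0
    have h1 : (𝟙 (pushforwardUnit g) : pushforwardUnit g ⟶ _).appₗ U (π 1) = 0 := by
      rw [h0.eq_of_src (𝟙 _) 0]
      rfl
    have h2 : π 1 = 0 := h1
    exact hp.not_isUnit (isUnit_of_dvd_one ((dvd_pow_self p hn).trans ((hπ0 1).1 h2)))
  · intro e he
    obtain ⟨r, hr⟩ := hπ (e.appₗ U (π 1))
    have hs (s : Γ(X, U)) : e.appₗ U (π s) = π (s * r) := by
      rw [← mul_one s, ← smul_eq_mul, LinearMap.map_smul, LinearMap.map_smul, ← hr,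
        ← LinearMap.map_smul]
      simp
    have hee : e.appₗ U (e.appₗ U (π 1)) = e.appₗ U (π 1) := congr(($he).appₗ U (π 1))
    rw [hs, hs, one_mul, ← sub_eq_zero, ← map_sub, hπ0] at hee
    have h1 : p ^ n ∣ r * (r - 1) := by rwa [mul_sub, mul_one]
    by_cases hpr : p ∣ r
    · left
      have h2 : ¬ p ∣ r - 1 := fun h ↦ hp.not_isUnit (isUnit_of_dvd_one ((dvd_sub_right hpr).1 h))
      have h3 := (hπ0 r).2 (hp.pow_dvd_of_dvd_mul_right n h2 h1)
      refine hom_ext_pushforwardUnit g hU (LinearMap.ext fun x ↦ ?_)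
      obtain ⟨s, rfl⟩ := hπ x
      rw [hs, ← smul_eq_mul, LinearMap.map_smul, h3, smul_zero]
      rfl
    · right
      have h3 := (hπ0 _).2 (hp.pow_dvd_of_dvd_mul_left n hpr h1)
      rw [map_sub, sub_eq_zero] at h3
      refine hom_ext_pushforwardUnit g hU (LinearMap.ext fun x ↦ ?_)
      obtain ⟨s, rfl⟩ := hπ x
      rw [hs, ← smul_eq_mul, LinearMap.map_smul, h3, ← LinearMap.map_smul, smul_eq_mul, mul_one]
      rfl

/-- The sections over `U` of the direct image of the structure sheaf are a cyclic module. -/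
def pushforwardUnitEquiv {U : X.Opens} (hg : Function.Surjective (g.app U)) {d : Γ(X, U)}
    (hker : RingHom.ker (g.app U).hom = Ideal.span {d}) :
    Γ(pushforwardUnit g, U) ≃ₗ[Γ(X, U)] Γ(X, U) ⧸ Ideal.span {d} :=
  ((Submodule.quotEquivOfEq _ _ (by
    ext x
    rw [← hker]
    rfl)).trans ((toPushforwardUnit g U).quotKerEquivOfSurjective hg)).symm

end AlgebraicGeometry.Scheme.Modules

namespace GPure

open Scheme.Modules

theorem isCoherent_pushforwardUnit {X Z : Scheme.{u}} (g : Z ⟶ X) [Subsingleton Z] [IsAffine Z]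
    {k : Type u} [Field k] (c : TwoCharts k X) (h : ((g.app ⊤).hom.comp c.const).Finite) :
    IsCoherent (pushforwardUnit g) :=
  ⟨isQuasicoherent_pushforwardUnit g c.isAffineOpen_U c.isAffineOpen_V c.sup_eq_top,
    fun W _ ↦ app_finite_of_subsingleton g c.const h W⟩

/-- Every power of a prime on a chart is the annihilator of an indecomposable torsion coherent
sheaf. -/
theorem TwoCharts.exists_torsion {k : Type u} [Field k] {X : Scheme.{u}} [IsIntegral X]
    (c : TwoCharts k X) {p : Γ(X, c.U)} (hp : Irreducible p) {n : ℕ} (hn : n ≠ 0) :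
    ∃ T : X.Modules, IsCoherent T ∧ IsTorsion T ∧ Indecomposable T ∧
      Nonempty (Γ(T, c.U) ≃ₗ[Γ(X, c.U)] Γ(X, c.U) ⧸ Ideal.span {p ^ n}) := by
  have := c.isDomain
  have := c.isPrincipalIdealRing
  let A : CommRingCat.{u} := .of (Γ(X, c.U) ⧸ Ideal.span {p ^ n})
  let q : Γ(X, c.U) ⟶ A := CommRingCat.ofHom (Ideal.Quotient.mk _)
  let g : Spec A ⟶ X := Spec.map q ≫ c.isAffineOpen_U.fromSpec
  have hU : g ⁻¹ᵁ c.U = ⊤ := by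
    simp [g]
  obtain ⟨e, he⟩ : ∃ e : A ≅ Γ(Spec A, g ⁻¹ᵁ c.U), g.app c.U = q ≫ e.hom := by
    let i : g ⁻¹ᵁ c.U ⟶ ⊤ := homOfLE le_top
    have hi : IsIso i := ⟨homOfLE hU.ge, Subsingleton.elim _ _, Subsingleton.elim _ _⟩
    refine ⟨asIso ((Scheme.ΓSpecIso A).inv ≫ (Spec A).presheaf.map i.op), ?_⟩
    rw [asIso_hom, ← Category.assoc, Scheme.ΓSpecIso_inv_naturality, Scheme.Hom.comp_app,
      c.isAffineOpen_U.fromSpec_app_self, Category.assoc, Category.assoc, Scheme.Hom.naturality]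
    rfl
  have hg : Function.Surjective (g.app c.U) := by
    rw [he]
    exact (ConcreteCategory.bijective_of_isIso e.hom).2.comp Ideal.Quotient.mk_surjective
  have hker : RingHom.ker (g.app c.U).hom = Ideal.span {p ^ n} := by
    ext x
    rw [he, RingHom.mem_ker]
    have h1 : e.hom (q x) = 0 ↔ q x = 0 :=
      map_eq_zero_iff e.hom.hom (ConcreteCategory.bijective_of_isIso e.hom).1
    exact h1.trans Ideal.Quotient.eq_zero_iff_mem
  -- Every prime containing `p ^ n` contains `p`, hence equals the maximal ideal generated by `p`.
  have hZ : Subsingleton (Spec A) := by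
    have hinj : Function.Injective (PrimeSpectrum.comap q.hom) :=
      PrimeSpectrum.comap_injective_of_surjective _ Ideal.Quotient.mk_surjective
    have hmax : (Ideal.span {p}).IsMaximal := PrincipalIdealRing.isMaximal_of_irreducible hp
    have key (x : PrimeSpectrum A) : (PrimeSpectrum.comap q.hom x).asIdeal = Ideal.span {p} := by
      refine (hmax.eq_of_le (PrimeSpectrum.comap q.hom x).2.ne_top ?_).symm
      rw [Ideal.span_singleton_le_iff_mem]
      refine (PrimeSpectrum.comap q.hom x).2.mem_of_pow_mem n ?_
      have h0 : q (p ^ n) = 0 :=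
        Ideal.Quotient.eq_zero_iff_mem.2 (Ideal.mem_span_singleton_self _)
      change q (p ^ n) ∈ x.asIdeal
      rw [h0]
      exact zero_mem _
    exact ⟨fun x y ↦ hinj (PrimeSpectrum.ext ((key x).trans (key y).symm))⟩
  -- `A` is a quotient of `k[x]` in which a nonzero preimage of `p ^ n` dies, so it is finite over
  -- `k`; this gives coherence on all affine opens at once.
  have hfin : ((g.app ⊤).hom.comp c.const).Finite := by
    let ε : Polynomial k →+* Γ(X, c.U) :=
      Polynomial.eval₂RingHom ((X.presheaf.map c.U.leTop.op).hom.comp c.const) c.t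
    obtain ⟨r, hr⟩ : ∃ r, ε r = p ^ n := c.surjective_U _
    have hr0 : r ≠ 0 := by
      rintro rfl
      rw [map_zero] at hr
      exact pow_ne_zero n hp.ne_zero hr.symm
    have h1 := Polynomial.finite_comp_C_of_surjective ((g.app c.U).hom.comp ε)
      (hg.comp c.surjective_U) hr0 (by
        rw [RingHom.comp_apply, hr, ← RingHom.mem_ker, hker]
        exact Ideal.mem_span_singleton_self _)
    let i := (TopologicalSpace.Opens.map g.base).map c.U.leTop
    let ρ := RingEquiv.ofBijective ((Spec A).presheaf.map i.op).hom
      ⟨map_injective_of_subsingleton i hU, map_surjective_of_subsingleton i⟩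
    have h2 := (RingHom.Finite.of_surjective ρ.symm.toRingHom ρ.symm.surjective).comp h1
    convert h2 using 1
    ext x
    apply ρ.injective
    change ρ _ = ρ (ρ.symm _)
    rw [RingEquiv.apply_symm_apply]
    refine (naturality_apply g c.U.leTop (c.const x)).symm.trans ?_
    simp [ε]
  refine ⟨pushforwardUnit g, isCoherent_pushforwardUnit g c hfin,
    isTorsion_pushforwardUnit g hU hp.ne_zero ⟨n, ?_⟩,
    indecomposable_pushforwardUnit g hU hg hp.prime hn hker, ⟨pushforwardUnitEquiv g hg hker⟩⟩
  rw [← map_pow]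
  have : p ^ n ∈ RingHom.ker (g.app c.U).hom := by
    rw [hker]
    exact Ideal.mem_span_singleton_self _
  exact this

end GPure

/-! ### Integrality of Proj and the charts of the projective line -/

namespace AlgebraicGeometry.Proj

open HomogeneousLocalization

variable {σ : Type*} {A : Type u} [CommRing A] [SetLike σ A] [AddSubgroupClass σ A] (𝒜 : ℕ → σ)
  [GradedRing 𝒜]

theorem isReduced_of_isDomain [IsDomain A] : AlgebraicGeometry.IsReduced (Proj 𝒜) := by
  have (x : Proj 𝒜) : _root_.IsReduced ((Proj 𝒜).presheaf.stalk x) := by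
    let p := x.asHomogeneousIdeal.toIdeal
    have hp : p.IsPrime := x.isPrime
    have h1 : IsDomain (Localization.AtPrime p) :=
      IsLocalization.isDomain_localization p.primeCompl_le_nonZeroDivisors
    let e := (algebraMap (AtPrime 𝒜 p) (Localization.AtPrime p)).comp (stalkIso 𝒜 x).hom.hom
    refine isReduced_of_injective e ?_
    exact (val_injective _).comp (ConcreteCategory.bijective_of_isIso (stalkIso 𝒜 x).hom).1
  exact isReduced_of_isReduced_stalk _

/-- The zero ideal is the generic point; the nonzero `f` of positive degree shows that it does not
contain the irrelevant ideal. -/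
theorem exists_forall_mem_basicOpen [IsDomain A] {f : A} {m : ℕ} (hf : f ∈ 𝒜 m) (hm : 0 < m)
    (hf0 : f ≠ 0) : ∃ η : Proj 𝒜, ∀ g ≠ 0, η ∈ basicOpen 𝒜 g :=
  let η : ProjectiveSpectrum 𝒜 :=
    { asHomogeneousIdeal := ⊥
      isPrime := Ideal.isPrime_bot
      not_irrelevant_le := fun h ↦ hf0 (h (by
        rw [HomogeneousIdeal.mem_irrelevant_iff, GradedRing.proj_apply,
          DirectSum.decompose_of_mem_ne 𝒜 hf hm.ne'])) }
  ⟨η, fun _ hg h ↦ hg h⟩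

theorem isIntegral_of_isDomain [IsDomain A] {f : A} {m : ℕ} (hf : f ∈ 𝒜 m) (hm : 0 < m)
    (hf0 : f ≠ 0) : AlgebraicGeometry.IsIntegral (Proj 𝒜) := by
  obtain ⟨η, hη₀⟩ := exists_forall_mem_basicOpen 𝒜 hf hm hf0
  have hη {U : Set (Proj 𝒜)} (hU : IsOpen U) (hU' : U.Nonempty) : η ∈ U := by
    obtain ⟨x, hx⟩ := hU'
    obtain ⟨_, ⟨g, rfl⟩, hxg, hgU⟩ :=
      (ProjectiveSpectrum.isTopologicalBasis_basic_opens 𝒜).exists_subset_of_mem_open hx hU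
    refine hgU (hη₀ g ?_)
    rintro rfl
    exact hxg (zero_mem _)
  have h1 : AlgebraicGeometry.IsReduced (Proj 𝒜) := isReduced_of_isDomain 𝒜
  have h2 : PreirreducibleSpace (Proj 𝒜) :=
    .of_forall_nonempty_inter fun U V hU hV hU' hV' ↦ ⟨η, hη hU hU', hη hV hV'⟩
  have h3 : IrreducibleSpace (Proj 𝒜) := ⟨⟨η⟩⟩
  exact isIntegral_of_irreducibleSpace_of_isReduced _

theorem inf_eq_basicOpen_awayToSection {f g : A} {d e : ℕ} (hf : f ∈ 𝒜 d) (hd : 0 < d)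
    (hg : g ∈ 𝒜 e) (he : 0 < e) : basicOpen 𝒜 f ⊓ basicOpen 𝒜 g =
      (Proj 𝒜).basicOpen (awayToSection 𝒜 f (Away.isLocalizationElem hf hg)) := by
  have hU := isAffineOpen_basicOpen 𝒜 f hf hd
  have h1 : Spec.map (awayToSection 𝒜 f) ≫ awayι 𝒜 f hf hd = hU.fromSpec := by
    have : hU.isoSpec.hom ≫ Spec.map (awayToSection 𝒜 f) = (basicOpenIsoSpec 𝒜 f hf hd).hom := by
      rw [basicOpenIsoSpec_hom]
      rfl
    rw [← basicOpenIsoSpec_inv_ι, ← hU.isoSpec_inv_ι, ← (Iso.inv_comp_eq _).2 this.symm,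
      Category.assoc, Iso.hom_inv_id_assoc]
  have h2 : hU.fromSpec ⁻¹ᵁ basicOpen 𝒜 g =
      PrimeSpectrum.basicOpen (awayToSection 𝒜 f (Away.isLocalizationElem hf hg)) := by
    rw [← h1, Scheme.Hom.comp_preimage, awayι_preimage_basicOpen 𝒜 hf hd hg he]
    rfl
  rw [← hU.fromSpec_image_basicOpen]
  have h3 := hU.fromSpec.image_preimage_eq_opensRange_inf (basicOpen 𝒜 g)
  rw [hU.opensRange_fromSpec, h2] at h3
  exact h3.symm

/-- Functions of degree zero are global sections of `Proj`. -/
def zeroToSection : 𝒜 0 →+* Γ(Proj 𝒜, ⊤) :=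
  ((Proj 𝒜).presheaf.map (homOfLE (basicOpen_one 𝒜).ge).op).hom.comp
    ((awayToSection 𝒜 1).hom.comp (fromZeroRingHom 𝒜 _))

end AlgebraicGeometry.Proj

namespace MvPolynomial

theorem IsHomogeneous.eval₂_mul {σ R S : Type*} [Fintype σ] [CommSemiring R] [CommSemiring S]
    {φ : MvPolynomial σ R} {n : ℕ} (hφ : φ.IsHomogeneous n) (g : R →+* S) (u : S) (w : σ → S) :
    MvPolynomial.eval₂ g (fun i ↦ u * w i) φ = u ^ n * MvPolynomial.eval₂ g w φ := by
  rw [MvPolynomial.eval₂_eq', MvPolynomial.eval₂_eq', Finset.mul_sum]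
  refine Finset.sum_congr rfl fun d hd ↦ ?_
  have hdn : ∑ i, d i = n := by
    rw [← hφ (MvPolynomial.mem_support_iff.1 hd)]
    simp [Finsupp.weight_apply, Finsupp.sum_fintype]
  rw [← hdn]
  simp only [mul_pow, Finset.prod_mul_distrib, Finset.prod_pow_eq_pow_sum]
  ring

end MvPolynomial

namespace GPure

open HomogeneousLocalization MvPolynomial

attribute [local instance] MvPolynomial.gradedAlgebra

variable (k : Type u) [Field k]

/-- The homogeneous elements of degree one given by the variables. -/
theorem X_mem_homogeneousSubmodule (i : Fin 2) :
    (X i : MvPolynomial (Fin 2) k) ∈ homogeneousSubmodule (Fin 2) k 1 :=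
  isHomogeneous_X _ _

/-- The coordinate `X j / X i`. -/
abbrev coord (i j : Fin 2) : Away (homogeneousSubmodule (Fin 2) k) (X i) :=
  Away.isLocalizationElem (X_mem_homogeneousSubmodule k i) (X_mem_homogeneousSubmodule k j)

/-- Dehomogenization: a fraction `a / X i ^ n` with `a` of degree `n` equals `a` evaluated at `X i ↦
1`, `X j ↦ X j / X i`. The identity is checked in the full localization, where `X i` is a unit. -/
theorem eval₂_coord_surjective {i j : Fin 2} (hij : i ≠ j) : Function.Surjective
    (Polynomial.eval₂RingHom ((fromZeroRingHom (homogeneousSubmodule (Fin 2) k)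
      (.powers (X i))).comp (algebraMap k _)) (coord k i j)) := by
  intro z
  obtain ⟨n, a, ha, rfl⟩ := Away.mk_surjective _ (X_mem_homogeneousSubmodule k i) z
  let L := Localization.Away (X i : MvPolynomial (Fin 2) k)
  let E := (algebraMap (Away (homogeneousSubmodule (Fin 2) k) (X i)) L).comp
    (Polynomial.eval₂RingHom ((fromZeroRingHom (homogeneousSubmodule (Fin 2) k)
      (.powers (X i))).comp (algebraMap k _)) (coord k i j))
  let w : Fin 2 → Polynomial k := fun l ↦ if l = i then 1 else Polynomial.X
  let u : L := algebraMap (MvPolynomial (Fin 2) k) L (X i)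
  have hu : IsUnit u := IsLocalization.Away.algebraMap_isUnit _
  have hw (l : Fin 2) : u * E (w l) = algebraMap (MvPolynomial (Fin 2) k) L (X l) := by
    by_cases hl : l = i
    · subst hl
      simp [w, u]
    · obtain rfl : l = j := by
        omega
      have h1 : E (w l) = Localization.mk (X l ^ 1) (⟨X i ^ 1, 1, rfl⟩ : Submonoid.powers (X i)) := by
        simp only [w, if_neg hl, E, RingHom.comp_apply, Polynomial.coe_eval₂RingHom,
          Polynomial.eval₂_X]
        rfl
      rw [h1, Localization.mk_eq_mk']
      simp only [pow_one]
      exact IsLocalization.mk'_spec' L (X l) (⟨X i, 1, pow_one _⟩ : Submonoid.powers (X i))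
  have hC (r : k) : E (Polynomial.C r) = algebraMap (MvPolynomial (Fin 2) k) L (C r) := by
    simp only [E, RingHom.comp_apply, Polynomial.coe_eval₂RingHom, Polynomial.eval₂_C]
    rfl
  have key : algebraMap (MvPolynomial (Fin 2) k) L a = u ^ n * E (MvPolynomial.eval₂ Polynomial.C w a) := by
    have ha' : a.IsHomogeneous n := by simpa using ha
    rw [MvPolynomial.hom_eval₂, ← ha'.eval₂_mul]
    conv_lhs => rw [← MvPolynomial.eval₂_eta a, MvPolynomial.hom_eval₂]
    congr 1
    · ext r
      exact (hC r).symm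
    · ext l
      exact (hw l).symm
  refine ⟨MvPolynomial.eval₂ Polynomial.C w a, val_injective _ ?_⟩
  change E _ = Localization.mk a _
  apply (hu.pow n).mul_left_cancel
  rw [← key, Localization.mk_eq_mk', ← map_pow]
  exact (IsLocalization.mk'_spec' _ _ _).symm

instance : IsIntegral (P1 k) :=
  Proj.isIntegral_of_isDomain (homogeneousSubmodule (Fin 2) k) (X_mem_homogeneousSubmodule k 0)
    one_pos (X_ne_zero 0)

theorem iSup_basicOpen_X : ⨆ i, Proj.basicOpen (homogeneousSubmodule (Fin 2) k) (X i) = ⊤ := by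
  refine Proj.iSup_basicOpen_eq_top' _ _ (fun i ↦ ⟨1, X_mem_homogeneousSubmodule k i⟩) ?_
  rw [eq_top_iff]
  rintro p -
  induction p using MvPolynomial.induction_on with
  | C r =>
    exact Subalgebra.algebraMap_mem _ (⟨C r, isHomogeneous_C _ r⟩ :
      homogeneousSubmodule (Fin 2) k 0)
  | add p q hp hq => exact add_mem hp hq
  | mul_X p i hp => exact mul_mem hp (Algebra.subset_adjoin ⟨i, rfl⟩)

theorem nonempty_basicOpen_X (i : Fin 2) :
    Nonempty (Proj.basicOpen (homogeneousSubmodule (Fin 2) k) (X i)) :=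
  have ⟨η, hη⟩ := Proj.exists_forall_mem_basicOpen (homogeneousSubmodule (Fin 2) k)
    (X_mem_homogeneousSubmodule k 0) one_pos (X_ne_zero 0)
  ⟨⟨η, hη _ (X_ne_zero i)⟩⟩

theorem surjective_chart {i j : Fin 2} (hij : i ≠ j) : Function.Surjective
    (Polynomial.eval₂RingHom (((Proj (homogeneousSubmodule (Fin 2) k)).presheaf.map
      (Proj.basicOpen (homogeneousSubmodule (Fin 2) k) (X i)).leTop.op).hom.comp
        ((Proj.zeroToSection (homogeneousSubmodule (Fin 2) k)).comp (algebraMap k _)))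
      (Proj.awayToSection (homogeneousSubmodule (Fin 2) k) (X i) (coord k i j))) := by
  intro z
  obtain ⟨y, rfl⟩ := (ConcreteCategory.bijective_of_isIso (Proj.basicOpenIsoAway
    (homogeneousSubmodule (Fin 2) k) (X i) (X_mem_homogeneousSubmodule k i) one_pos).hom).2 z
  obtain ⟨q, rfl⟩ := eval₂_coord_surjective k hij y
  refine ⟨q, ?_⟩
  rw [Proj.basicOpenIsoAway_hom]
  refine Eq.trans ?_ (Polynomial.hom_eval₂ q _ (Proj.awayToSection (homogeneousSubmodule (Fin 2) k)
    (X i)).hom _).symm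
  rw [Polynomial.coe_eval₂RingHom]
  congr 1

/-- The standard charts of the projective line. -/
def charts : TwoCharts k (P1 k) where
  U := Proj.basicOpen (homogeneousSubmodule (Fin 2) k) (X 0)
  V := Proj.basicOpen (homogeneousSubmodule (Fin 2) k) (X 1)
  isAffineOpen_U := Proj.isAffineOpen_basicOpen _ _ (X_mem_homogeneousSubmodule k 0) one_pos
  isAffineOpen_V := Proj.isAffineOpen_basicOpen _ _ (X_mem_homogeneousSubmodule k 1) one_pos
  sup_eq_top := by
    rw [eq_top_iff]
    refine (iSup_basicOpen_X k).ge.trans (iSup_le fun i ↦ ?_)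
    fin_cases i
    exacts [le_sup_left, le_sup_right]
  nonempty_U := nonempty_basicOpen_X k 0
  nonempty_V := nonempty_basicOpen_X k 1
  const := (Proj.zeroToSection (homogeneousSubmodule (Fin 2) k)).comp (algebraMap k _)
  t := Proj.awayToSection (homogeneousSubmodule (Fin 2) k) (X 0) (coord k 0 1)
  s := Proj.awayToSection (homogeneousSubmodule (Fin 2) k) (X 1) (coord k 1 0)
  inf_eq_t := Proj.inf_eq_basicOpen_awayToSection _ (X_mem_homogeneousSubmodule k 0) one_pos
    (X_mem_homogeneousSubmodule k 1) one_pos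
  inf_eq_s := (inf_comm _ _).trans (Proj.inf_eq_basicOpen_awayToSection _
    (X_mem_homogeneousSubmodule k 1) one_pos (X_mem_homogeneousSubmodule k 0) one_pos)
  surjective_U := surjective_chart k zero_ne_one
  surjective_V := surjective_chart k one_ne_zero

end GPure

/-! ### From the global conditions to torsion lifting, and the equivalences -/

namespace GPure

open Scheme.Modules

/-- A condition on a single module of the form `R / p ^ n` suffices for all powers of
irreducibles. -/
theorem TwoCharts.liftsTorsionBy {k : Type u} [Field k] {X : Scheme.{u}} [IsIntegral X]
    (c : TwoCharts k X) {B C : X.Modules} (g : B ⟶ C) (hg : Function.Surjective (g.appₗ c.U))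
    (H : ∀ T : X.Modules, IsCoherent T → IsTorsion T → Indecomposable T → ∀ d : Γ(X, c.U),
      Nonempty (Γ(T, c.U) ≃ₗ[Γ(X, c.U)] Γ(X, c.U) ⧸ Ideal.span {d}) →
        (g.appₗ c.U).LiftsTorsionBy d) (d : Γ(X, c.U)) : (g.appₗ c.U).LiftsTorsionBy d := by
  have := c.isDomain
  have := c.isPrincipalIdealRing
  refine LinearMap.liftsTorsionBy_of_irreducible_pow hg (fun p hp n ↦ ?_) d
  -- For `n = 0` the quotient `R / p ^ n` is zero, hence not indecomposable, and only the zero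
  -- section is to be lifted.
  obtain rfl | hn := eq_or_ne n 0
  · intro x hx
    rw [pow_zero, one_smul] at hx
    exact ⟨0, smul_zero _, by rw [hx, _root_.map_zero]⟩
  · obtain ⟨T, hT, hT', hT'', he⟩ := c.exists_torsion hp hn
    exact H T hT hT' hT'' _ he

/-- Hom is left exact and `QCoh X` is a full subcategory, so surjectivity onto maps to the third
term is the only real condition. -/
theorem shortExact_map_preadditiveCoyoneda_iff {X : Scheme.{u}} {S : ShortComplex (QCoh X)}
    (hS : (S.map (QCoh.incl X)).ShortExact) (T : QCoh X) :
    (S.map (preadditiveCoyoneda.obj (op T))).ShortExact ↔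
      ∀ φ : T.obj ⟶ S.X₃.obj, ∃ ψ : T.obj ⟶ S.X₂.obj, ψ ≫ S.g.hom = φ := by
  have hm : Mono (S.map (QCoh.incl X)).f := hS.mono_f
  constructor
  · intro h φ
    have he := h.epi_g
    rw [AddCommGrpCat.epi_iff_surjective] at he
    obtain ⟨ψ, hψ⟩ := he (ObjectProperty.homMk φ)
    exact ⟨ψ.hom, congr(($hψ).hom)⟩
  · intro h
    have hinj : Function.Injective ((preadditiveCoyoneda.obj (op T)).map S.f) := by
      intro a b hab
      have h1 : a.hom ≫ (S.map (QCoh.incl X)).f = b.hom ≫ (S.map (QCoh.incl X)).f :=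
        congr(InducedCategory.Hom.hom $hab)
      exact InducedCategory.hom_ext (hm.right_cancellation _ _ h1)
    have hsurj : Function.Surjective ((preadditiveCoyoneda.obj (op T)).map S.g) := by
      intro φ
      obtain ⟨ψ, hψ⟩ := h φ.hom
      exact ⟨ObjectProperty.homMk ψ, InducedCategory.hom_ext hψ⟩
    have hex : (S.map (preadditiveCoyoneda.obj (op T))).Exact := by
      rw [ShortComplex.ab_exact_iff]
      intro x hx
      have hx' : x.hom ≫ (S.map (QCoh.incl X)).g = 0 := congr(InducedCategory.Hom.hom $hx)
      obtain ⟨l, hl⟩ := hS.exact.lift' x.hom hx'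
      exact ⟨ObjectProperty.homMk l, InducedCategory.hom_ext hl⟩
    exact
      { exact := hex
        mono_f := (AddCommGrpCat.mono_iff_injective _).2 hinj
        epi_g := (AddCommGrpCat.epi_iff_surjective _).2 hsurj }

theorem TwoCharts.liftsTorsionBy_of_shortExact_tensor {k : Type u} [Field k] {X : Scheme.{u}}
    [IsIntegral X] (c : TwoCharts k X) {S : ShortComplex X.Modules} (hS : S.ShortExact)
    [S.X₁.IsQuasicoherent] [S.X₂.IsQuasicoherent] [S.X₃.IsQuasicoherent]
    (H : ∀ T : X.Modules, IsCoherent T → IsTorsion T → Indecomposable T →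
      (S.map (sheafTensor T)).ShortExact) (d : Γ(X, c.U)) : (S.g.appₗ c.U).LiftsTorsionBy d := by
  have := hS.epi_g
  have hg := app_surjective_of_epi S.g c.isAffineOpen_U
  refine c.liftsTorsionBy S.g hg (fun T hT hT' hT'' d ⟨e⟩ ↦ ?_) d
  have h1 : Mono ((sheafTensor T).map S.f) := (H T hT hT' hT'').mono_f
  have := hT.1
  exact LinearMap.liftsTorsionBy_of_lTensor_injective (f := S.f.appₗ c.U)
    (g := S.g.appₗ c.U) (exact_app hS c.U) hg e
    (lTensor_injective_of_mono_map_sheafTensor T S.f c.isAffineOpen_U)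

theorem TwoCharts.liftsTorsionBy_of_forall_exists_lift {k : Type u} [Field k] {X : Scheme.{u}}
    [IsIntegral X] (c : TwoCharts k X) {S : ShortComplex X.Modules} (hS : S.ShortExact)
    [S.X₂.IsQuasicoherent] [S.X₃.IsQuasicoherent]
    (H : ∀ T : X.Modules, IsCoherent T → IsTorsion T → Indecomposable T →
      ∀ φ : T ⟶ S.X₃, ∃ ψ : T ⟶ S.X₂, ψ ≫ S.g = φ) (d : Γ(X, c.U)) :
    (S.g.appₗ c.U).LiftsTorsionBy d := by
  have := hS.epi_g
  exact c.liftsTorsionBy S.g (app_surjective_of_epi S.g c.isAffineOpen_U)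
    (fun T hT hT' hT'' d ⟨e⟩ ↦ c.liftsTorsionBy_of_exists_lift S.g hT hT' e (H T hT hT' hT'')) d

end GPure

end

theorem mainTheorem12 {k : Type u} [Field k] (S : ShortComplex (GPure.QCoh (GPure.P1 k)))
    (hS : (S.map (GPure.QCoh.incl (GPure.P1 k))).ShortExact) :
    List.TFAE [
      GPure.IsGPureExact (S.map (GPure.QCoh.incl (GPure.P1 k))),
      ∀ T : GPure.QCoh (GPure.P1 k), GPure.IsCoherent T.obj → GPure.IsTorsion T.obj →
        ((S.map (GPure.QCoh.incl (GPure.P1 k))).map (GPure.sheafTensor T.obj)).ShortExact,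
      ∀ T : GPure.QCoh (GPure.P1 k), GPure.IsCoherent T.obj → GPure.IsTorsion T.obj →
        Indecomposable T.obj →
        ((S.map (GPure.QCoh.incl (GPure.P1 k))).map (GPure.sheafTensor T.obj)).ShortExact,
      ∀ T : GPure.QCoh (GPure.P1 k), GPure.IsCoherent T.obj → GPure.IsTorsion T.obj →
        (S.map (preadditiveCoyoneda.obj (op T))).ShortExact,
      ∀ T : GPure.QCoh (GPure.P1 k), GPure.IsCoherent T.obj → GPure.IsTorsion T.obj →
        Indecomposable T.obj →
        (S.map (preadditiveCoyoneda.obj (op T))).ShortExact] := by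
  let c := GPure.charts k
  have h₁ : (S.map (GPure.QCoh.incl (GPure.P1 k))).X₁.IsQuasicoherent :=
    S.X₁.property
  have h₂ : (S.map (GPure.QCoh.incl (GPure.P1 k))).X₂.IsQuasicoherent :=
    S.X₂.property
  have h₃ : (S.map (GPure.QCoh.incl (GPure.P1 k))).X₃.IsQuasicoherent :=
    S.X₃.property
  tfae_have 1 → 2 := fun h T _ _ ↦ h T.obj
  tfae_have 2 → 3 := fun h T hT hT' _ ↦ h T hT hT'
  -- The local lifting property is obtained on both charts, the second through `swap`.
  tfae_have 3 → 1 := fun h ↦ by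
    have H (T : (GPure.P1 k).Modules) (hT : GPure.IsCoherent T) := h ⟨T, hT.1⟩ hT
    exact c.isGPureExact hS (c.liftsTorsionBy_of_shortExact_tensor hS H)
      (c.swap.liftsTorsionBy_of_shortExact_tensor hS H)
  tfae_have 1 → 4 := fun h T hT hT' ↦ by
    have H (T : (GPure.P1 k).Modules) (_ : GPure.IsCoherent T) (_ : GPure.IsTorsion T)
      (_ : Indecomposable T) := h T
    rw [GPure.shortExact_map_preadditiveCoyoneda_iff hS]
    exact c.exists_lift hS (c.liftsTorsionBy_of_shortExact_tensor hS H)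
      (c.swap.liftsTorsionBy_of_shortExact_tensor hS H) hT hT'
  tfae_have 4 → 5 := fun h T hT hT' _ ↦ h T hT hT'
  tfae_have 5 → 1 := fun h ↦ by
    have H (T : (GPure.P1 k).Modules) (hT : GPure.IsCoherent T) (hT' : GPure.IsTorsion T)
        (hT'' : Indecomposable T) :=
      (GPure.shortExact_map_preadditiveCoyoneda_iff hS ⟨T, hT.1⟩).1 (h ⟨T, hT.1⟩ hT hT' hT'')
    exact c.isGPureExact hS (c.liftsTorsionBy_of_forall_exists_lift hS H)
      (c.swap.liftsTorsionBy_of_forall_exists_lift hS H)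
  tfae_finish
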